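/- **Setting.** Let $f:\mathbb R^{d_x}\to\mathbb R^{d_y}$ be Lipschitz on $[0,1]^{d_x}$, and let $Y_i=f(X_i)+\xi_i$, $i\ge 1$, where the pairs $(X_i,\xi_i)$ are i.i.d., $\xi_i$ is independent of $X_i$, and the law of $X_i$ is concentrated on $[0,1]^{d_x}$ and bounded below there by a positive multiple of Lebesgue measure. Fix $x\in[0,1]^{d_x}$ and let $\mu_{Y|x}$ be the law of $f(x)+\xi_1$. Let $K:\mathbb R^{d_x}\to[0,\infty)$ be measurable with $b_1\mathbf 1\{\|u\|_2\le r_1\}\le K(u)\le b_2\mathbf 1\{\|u\|_2\le r_2\}$ for some $0<r_1\le r_2$, $0<b_1\le b_2$, and let $h_n>0$ satisfy $h_n\to0$ and $nh_n^{d_x}\to\infty$. Put $w_i=K((x-X_i)/h_n)/\sum_{j\le n}K((x-X_j)/h_n)$ and $\hat\mu_Y=\sum_{i\le n}w_i\delta_{Y_i}$. Let $1\le p<\infty$ and $1/p+1/p^*=1$. Let $\mathcal Y\subseteq\mathbb R^{d_y}$ be closed and convex with $Y_i\in\mathcal Y$ almost surely and $\mu_{Y|x}(\partial\mathcal Y)=0$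 (no condition on the boundary if $\mathcal Y=\mathbb R^{d_y}$); if $p=1$, assume also that $\mathcal Y$ is contained in the support of $\mu_{Y|x}$. Let $\mathcal W_p$ be the type-$p$ Wasserstein distance with ground metric $\|u-v\|_p$, and let $B^p_\varepsilon(\hat\mu_Y)$ be the set of probability distributions $\mu$ on $\mathcal Y$ with $\mathcal W_p(\hat\mu_Y,\mu)\le\varepsilon$. Let $\varepsilon_n(\alpha)=\sqrt{\log(c_1/\alpha)/(c_2n)}$ with $c_2>0$, and let $0<\alpha_n<c_1$ be such that $\varepsilon_n:=\varepsilon_n(\alpha_n)\to0$. Fix $z$ and assume that $c(z,\cdot)$ is Lipschitz on $\mathcal Y$, and differentiable on $\mathcal Y$ with $\|\nabla_yc(z,y_1)-\nabla_yc(z,y_2)\|\le h_z(y_2)\|y_1-y_2\|^\kappa$ for all $y_1,y_2\in\mathcal Y$, for some $\kappa\in(0,1]$ and some $h_z$ bounded on $\mathcal Y$. Put $$\|\nabla_yc(z,\cdot)\|_{\hat\mu_Y,q}=\Big(\sum_{i\le n}w_i\|\nabla_yc(z,Y_i)\|_q^q\Big)^{1/q}\ (1\le q<\infty),\qquad \|\nabla_yc(z,\cdot)\|_{\hat\mu_Y,\infty}=\max_{i\le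 n}\|\nabla_yc(z,Y_i)\|_\infty .$$ **Proposition.** The weights are well defined with probability tending to one. Almost surely, for every $n$ for which they are, $c(z,\cdot)$ is integrable under every $\mu\in B^p_{\varepsilon_n}(\hat\mu_Y)$ and the worst-case cost over this ball is a finite supremum over a non-empty set. Moreover $$\Big|\sup_{\mu\in B^p_{\varepsilon_n}(\hat\mu_Y)}\mathbb E_\mu[c(z,Y)]-\Big(\mathbb E_{\hat\mu_Y}[c(z,Y)]+\varepsilon_n\,\|\nabla_yc(z,\cdot)\|_{\hat\mu_Y,p^*}\Big)\Big|=o_p(\varepsilon_n),$$ that is, the left side divided by $\varepsilon_n$ tends to zero in probability. If in addition $nh_n^{d_x}/\log n\to\infty$, then almost surely the weights are well defined for all large $n$ and this ratio tends to zero. -/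

import Mathlib

open Filter Topology MeasureTheory ProbabilityTheory
open scoped ENNReal NNReal

noncomputable section

namespace NWDRO

/-- The space `ℝ^d`, with its Euclidean structure. -/
abbrev Vec (d : ℕ) : Type := EuclideanSpace ℝ (Fin d)

/-- The `ℓ_q`-norm of a vector of `ℝ^d`, for an exponent `1 ≤ q ≤ ∞`. -/
def lqNorm {d : ℕ} (q : ℝ≥0∞) (v : Vec d) : ℝ :=
  ‖(WithLp.toLp q (fun j => v j) : PiLp q (fun _ : Fin d => ℝ))‖

/-! ### Wasserstein distance and ambiguity sets -/

/-- The type-`p` Wasserstein distance, `1 ≤ p < ∞`, with the ground metric given by the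
`ℓ_p`-norm: the infimum over the couplings `π` of `μ` and `ν` of
`(∫ ‖u - v‖_p ^ p dπ(u, v)) ^ (1 / p)`. -/
def wasserstein {d : ℕ} (p : ℝ≥0∞) (μ ν : Measure (Vec d)) : ℝ≥0∞ :=
  ⨅ (π : Measure (Vec d × Vec d)) (_ : π.map Prod.fst = μ) (_ : π.map Prod.snd = ν),
    (∫⁻ uv, ENNReal.ofReal (lqNorm p (uv.1 - uv.2)) ^ p.toReal ∂π) ^ (1 / p.toReal)

/-- The Wasserstein ball of radius `r` around `μ₀`, among the probability distributions on
the domain `𝒴`. -/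
def ambiguitySet {d : ℕ} (p : ℝ≥0∞) (𝒴 : Set (Vec d)) (μ₀ : Measure (Vec d)) (r : ℝ) :
    Set (Measure (Vec d)) :=
  {μ | IsProbabilityMeasure μ ∧ μ 𝒴ᶜ = 0 ∧ wasserstein p μ₀ μ ≤ ENNReal.ofReal r}

/-- The expected costs `E_μ[g]` of the distributions `μ` in the Wasserstein ball. -/
def ballCosts {d : ℕ} (p : ℝ≥0∞) (𝒴 : Set (Vec d)) (μ₀ : Measure (Vec d)) (r : ℝ)
    (g : Vec d → ℝ) : Set ℝ :=
  (fun μ : Measure (Vec d) => ∫ y, g y ∂μ) '' ambiguitySet p 𝒴 μ₀ r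

/-- The worst-case expected cost over the Wasserstein ball. -/
def worstCaseCost {d : ℕ} (p : ℝ≥0∞) (𝒴 : Set (Vec d)) (μ₀ : Measure (Vec d)) (r : ℝ)
    (g : Vec d → ℝ) : ℝ :=
  sSup (ballCosts p 𝒴 μ₀ r g)

/-! ### The Nadaraya-Watson nominal distribution -/

/-- The total kernel mass `∑_j K((x - x_j) / h)` of the samples around `x`. -/
def kernelMass {m n : ℕ} (K : Vec m → ℝ) (h : ℝ) (x : Vec m) (xs : Fin n → Vec m) : ℝ :=
  ∑ j, K (h⁻¹ • (x - xs j))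

/-- The Nadaraya-Watson weight `w_i = K((x - x_i) / h) / ∑_j K((x - x_j) / h)`. -/
def nwWeight {m n : ℕ} (K : Vec m → ℝ) (h : ℝ) (x : Vec m) (xs : Fin n → Vec m)
    (i : Fin n) : ℝ :=
  K (h⁻¹ • (x - xs i)) / kernelMass K h x xs

/-- The nominal distribution `∑_i w_i δ_{y_i}`. -/
def weightedEmpirical {d n : ℕ} (w : Fin n → ℝ) (ys : Fin n → Vec d) : Measure (Vec d) :=
  ∑ i, ENNReal.ofReal (w i) • Measure.dirac (ys i)

/-- The weighted empirical norm of the gradient of `g` at the samples: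
`(∑_i w_i ‖∇g(y_i)‖_q ^ q) ^ (1 / q)` for `1 ≤ q < ∞`, and `max_i ‖∇g(y_i)‖_∞` for `q = ∞`.
The gradient is taken within the domain `𝒴`. -/
def gradNorm {d n : ℕ} (q : ℝ≥0∞) (𝒴 : Set (Vec d)) (w : Fin n → ℝ) (ys : Fin n → Vec d)
    (g : Vec d → ℝ) : ℝ :=
  if q = ⊤ then ⨆ i, lqNorm ⊤ (gradientWithin g 𝒴 (ys i))
  else (∑ i, w i * lqNorm q (gradientWithin g 𝒴 (ys i)) ^ q.toReal) ^ (1 / q.toReal)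

/-- The error of the gradient-regularization approximation: the absolute difference of the
worst-case cost over the ball of radius `r` around the nominal distribution, and the nominal
cost plus `r` times the weighted gradient norm. -/
def regularizationError {d n : ℕ} (p q : ℝ≥0∞) (𝒴 : Set (Vec d)) (w : Fin n → ℝ)
    (ys : Fin n → Vec d) (r : ℝ) (g : Vec d → ℝ) : ℝ :=
  |worstCaseCost p 𝒴 (weightedEmpirical w ys) r g -
    ((∫ y, g y ∂(weightedEmpirical w ys)) + r * gradNorm q 𝒴 w ys g)|

/-- The radius `ε_n(α) = √(log(c₁ / α) / (c₂ n))`. -/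
def radius (c₁ c₂ : ℝ) (n : ℕ) (α : ℝ) : ℝ :=
  Real.sqrt (Real.log (c₁ / α) / (c₂ * n))

/-! ### Assumptions -/

/-- Regularity of a cost function `g = c(z, ·)` on the domain `𝒴`: it is Lipschitz, and it is
differentiable with a gradient that is Hölder continuous of some exponent `κ ∈ (0, 1]`, with a
bounded modulus. -/
structure RegularCost {d : ℕ} (𝒴 : Set (Vec d)) (g : Vec d → ℝ) : Prop where
  lipschitz : ∃ L : ℝ≥0, LipschitzOnWith L g 𝒴
  differentiable : DifferentiableOn ℝ g 𝒴
  holder : ∃ (κ : ℝ) (H : Vec d → ℝ) (B : ℝ), 0 < κ ∧ κ ≤ 1 ∧ (∀ y ∈ 𝒴, |H y| ≤ B) ∧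
    ∀ y₁ ∈ 𝒴, ∀ y₂ ∈ 𝒴,
      ‖gradientWithin g 𝒴 y₁ - gradientWithin g 𝒴 y₂‖ ≤ H y₂ * ‖y₁ - y₂‖ ^ κ

/-- The cube `[0, 1]^m`. -/
def unitCube (m : ℕ) : Set (Vec m) := {u | ∀ j, 0 ≤ u j ∧ u j ≤ 1}

/-- The generative model of the samples `(X_i, Y_i)` with `Y_i = f(X_i) + ξ_i`: the pairs
`(X_i, ξ_i)` are i.i.d., the noise `ξ_i` is independent of the covariate `X_i`, the law `μX` of
the covariates lives on the cube and is bounded below there by a positive multiple of the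
Lebesgue measure, and `f` is Lipschitz on the cube. -/
structure SamplingModel {Ω : Type*} [MeasurableSpace Ω] (P : Measure Ω) {m d : ℕ}
    (X : ℕ → Ω → Vec m) (ξ : ℕ → Ω → Vec d) (f : Vec m → Vec d)
    (μX : Measure (Vec m)) (μξ : Measure (Vec d)) : Prop where
  measurable_covariate : ∀ i, Measurable (X i)
  measurable_noise : ∀ i, Measurable (ξ i)
  law_covariate : ∀ i, P.map (X i) = μX
  law_noise : ∀ i, P.map (ξ i) = μξ
  indep_samples : iIndepFun (fun i ω => (X i ω, ξ i ω)) P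
  indep_noise : ∀ i, IndepFun (X i) (ξ i) P
  covariate_mem_cube : μX (unitCube m)ᶜ = 0
  covariate_lower_bound : ∃ b : ℝ, 0 < b ∧
    ENNReal.ofReal b • (volume : Measure (Vec m)).restrict (unitCube m) ≤ μX
  lipschitz_regression : ∃ L : ℝ≥0, LipschitzOnWith L f (unitCube m)

/-- The conditional law `μ_{Y|x}` of `Y = f(x) + ξ`. -/
def condLaw {m d : ℕ} (f : Vec m → Vec d) (μξ : Measure (Vec d)) (x : Vec m) :
    Measure (Vec d) :=
  μξ.map (fun e => f x + e)

/-- A kernel between two multiples of naive kernels: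
`b₁ 1{‖u‖₂ ≤ r₁} ≤ K(u) ≤ b₂ 1{‖u‖₂ ≤ r₂}`. -/
structure IsNWKernel {m : ℕ} (K : Vec m → ℝ) : Prop where
  measurable : Measurable K
  bounds : ∃ r₁ r₂ b₁ b₂ : ℝ, 0 < r₁ ∧ r₁ ≤ r₂ ∧ 0 < b₁ ∧ b₁ ≤ b₂ ∧
    ∀ u, (if ‖u‖ ≤ r₁ then b₁ else 0) ≤ K u ∧ K u ≤ (if ‖u‖ ≤ r₂ then b₂ else 0)

/-- `A_n = o_p(β_n)`: the ratio `A_n / β_n` converges to zero in probability. -/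
def IsLittleOInProb {Ω : Type*} [MeasurableSpace Ω] (P : Measure Ω) (A : ℕ → Ω → ℝ)
    (β : ℕ → ℝ) : Prop :=
  TendstoInMeasure P (fun n ω => A n ω / β n) atTop (fun _ => 0)

end NWDRO

end

namespace NWDRO

/-! The proof combines a deterministic expansion, uniform over all weighted samples, with an
exponential bound on the probability that a sample violates its hypotheses. Write `N` for the
weighted gradient norm and `r` for the radius.

For `1 < p`, the increment `g v - g u` is at most `‖∇g(u)‖_q ‖v - u‖_p` plus a small multiple of `‖v
- u‖_p` plus a multiple of `‖v - u‖_p ^ p` (`RegularCost.sub_le`). Integrated over a coupling,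
Hölder's inequality turns the leading term into `r N`, and the remainder is `o(r)` because `p > 1`
(`exists_radius_integral_le`). Conversely, moving each atom along the vector dual to its gradient is
the equality case of Hölder and gains `r N` to first order. Atoms too close to the boundary stay
put, at a loss proportional to `r` times their weight (`exists_radius_le_worstCaseCost`).

For `p = 1` mass can be concentrated, and the relevant slope is the supremum of `‖∇g‖_∞` over `𝒴`.
It bounds the gain from above by the mean value theorem. It is nearly attained from below by moving
only the samples near a near-maximizer `y` (`RegularCost.le_worstCaseCost_one`), which also bring
the maximal sample gradient close to the supremum. The support hypothesis ensures that such samples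
carry weight.

The weights depend on the covariates alone, which are independent of the noises, so the weighted
proportion of noises in a set `A` rarely exceeds `μξ A` by much. A Chernoff bound gives failure
probability `exp (-c n h ^ m)` (`SamplingModel.exists_measure_weight_le`). Samples of positive
weight lie within `O(h)` of `f x + ξ i`, a sample of the conditional law. The bound tends to zero
when `n h ^ m → ∞`, and is summable when `n h ^ m / log n → ∞`. -/

/-! ### The `ℓ_q`-norms and their duality -/

lemma lqNorm_nonneg {d : ℕ} {q : ℝ≥0∞} (hq : 1 ≤ q) (v : Vec d) : 0 ≤ lqNorm q v := by
  have : Fact (1 ≤ q) := ⟨hq⟩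
  exact norm_nonneg _

lemma abs_apply_le_lqNorm {d : ℕ} {q : ℝ≥0∞} (hq : 1 ≤ q) (v : Vec d) (j : Fin d) :
    |v j| ≤ lqNorm q v := by
  have : Fact (1 ≤ q) := ⟨hq⟩
  exact PiLp.norm_apply_le (WithLp.toLp q (fun j => v j) : PiLp q (fun _ : Fin d => ℝ)) j

lemma lqNorm_le_sum_abs {d : ℕ} {q : ℝ≥0∞} (hq : 1 ≤ q) (v : Vec d) :
    lqNorm q v ≤ ∑ j, |v j| := by
  have : Fact (1 ≤ q) := ⟨hq⟩
  have h : (WithLp.toLp q (fun j => v j) : PiLp q (fun _ : Fin d => ℝ)) =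
      ∑ j, PiLp.single q j (v j) := by
    ext j
    simp
  unfold lqNorm
  rw [h]
  refine (norm_sum_le _ _).trans (le_of_eq ?_)
  simp

lemma lqNorm_two {d : ℕ} (v : Vec d) : lqNorm 2 v = ‖v‖ := rfl

lemma lqNorm_le_mul_lqNorm {d : ℕ} {p q : ℝ≥0∞} (hp : 1 ≤ p) (hq : 1 ≤ q) (v : Vec d) :
    lqNorm p v ≤ d * lqNorm q v := by
  refine (lqNorm_le_sum_abs hp v).trans ?_
  refine (Finset.sum_le_sum fun j _ => abs_apply_le_lqNorm hq v j).trans ?_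
  simp

lemma norm_le_mul_lqNorm {d : ℕ} {q : ℝ≥0∞} (hq : 1 ≤ q) (v : Vec d) :
    ‖v‖ ≤ d * lqNorm q v :=
  lqNorm_two v ▸ lqNorm_le_mul_lqNorm (by norm_num) hq v

lemma lqNorm_le_mul_norm {d : ℕ} {q : ℝ≥0∞} (hq : 1 ≤ q) (v : Vec d) :
    lqNorm q v ≤ d * ‖v‖ :=
  lqNorm_two v ▸ lqNorm_le_mul_lqNorm hq (by norm_num) v

lemma lqNorm_add_le {d : ℕ} {q : ℝ≥0∞} (hq : 1 ≤ q) (u v : Vec d) :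
    lqNorm q (u + v) ≤ lqNorm q u + lqNorm q v := by
  have : Fact (1 ≤ q) := ⟨hq⟩
  exact norm_add_le (WithLp.toLp q (fun j => u j) : PiLp q (fun _ : Fin d => ℝ))
    (WithLp.toLp q (fun j => v j))

lemma lqNorm_neg {d : ℕ} {q : ℝ≥0∞} (hq : 1 ≤ q) (v : Vec d) :
    lqNorm q (-v) = lqNorm q v := by
  have : Fact (1 ≤ q) := ⟨hq⟩
  exact norm_neg (WithLp.toLp q (fun j => v j) : PiLp q (fun _ : Fin d => ℝ))

lemma lqNorm_sub_comm {d : ℕ} {q : ℝ≥0∞} (hq : 1 ≤ q) (u v : Vec d) :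
    lqNorm q (u - v) = lqNorm q (v - u) := by
  rw [← neg_sub, lqNorm_neg hq]

lemma lqNorm_zero {d : ℕ} {q : ℝ≥0∞} (hq : 1 ≤ q) : lqNorm q (0 : Vec d) = 0 := by
  have : Fact (1 ≤ q) := ⟨hq⟩
  exact norm_zero (E := PiLp q (fun _ : Fin d => ℝ))

lemma lqNorm_smul {d : ℕ} {q : ℝ≥0∞} (hq : 1 ≤ q) (a : ℝ) (v : Vec d) :
    lqNorm q (a • v) = |a| * lqNorm q v := by
  have : Fact (1 ≤ q) := ⟨hq⟩
  exact norm_smul a (WithLp.toLp q (fun j => v j) : PiLp q (fun _ : Fin d => ℝ))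

lemma continuous_lqNorm {d : ℕ} {q : ℝ≥0∞} (hq : 1 ≤ q) :
    Continuous (lqNorm q : Vec d → ℝ) := by
  have : Fact (1 ≤ q) := ⟨hq⟩
  have h : Continuous fun v : Vec d =>
      (WithLp.toLp q (fun j => v j) : PiLp q (fun _ : Fin d => ℝ)) :=
    (PiLp.continuous_toLp q _).comp (by fun_prop)
  exact continuous_norm.comp h

lemma lqNorm_rpow {d : ℕ} {q : ℝ≥0∞} (hq : 1 ≤ q) (hqt : q ≠ ⊤) (v : Vec d) :
    lqNorm q v ^ q.toReal = ∑ j, |v j| ^ q.toReal := by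
  have h0 : 0 < q.toReal := ENNReal.toReal_pos (by positivity) hqt
  unfold lqNorm
  rw [PiLp.norm_eq_sum h0, ← Real.rpow_mul (by positivity)]
  simp [h0.ne']

lemma lqNorm_one {d : ℕ} (v : Vec d) : lqNorm 1 v = ∑ j, |v j| := by
  have := lqNorm_rpow (q := 1) le_rfl (by simp) v
  simpa using this

lemma lqNorm_top_le {d : ℕ} (v : Vec d) {B : ℝ} (hB : 0 ≤ B) (h : ∀ j, |v j| ≤ B) :
    lqNorm ⊤ v ≤ B := by
  unfold lqNorm
  rw [PiLp.norm_eq_ciSup]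
  exact Real.iSup_le h hB

lemma inner_eq_sum {d : ℕ} (a b : Vec d) : inner ℝ a b = ∑ j, a j * b j := by
  simp [PiLp.inner_apply, mul_comm]

lemma inner_le_lqNorm_mul_lqNorm {d : ℕ} {p q : ℝ≥0∞} (hp : p ≠ ⊤)
    (hpq : ENNReal.HolderConjugate p q) (a b : Vec d) :
    inner ℝ a b ≤ lqNorm q a * lqNorm p b := by
  rw [inner_eq_sum]
  rcases eq_or_ne q ⊤ with rfl | hq
  · have hp1 : p = 1 := by
      have := hpq.inv_add_inv_eq_one
      simpa using this
    subst hp1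
    rw [lqNorm_one, Finset.mul_sum]
    refine Finset.sum_le_sum fun j _ => (le_abs_self _).trans ?_
    rw [abs_mul]
    gcongr
    exact abs_apply_le_lqNorm le_top a j
  · have hc := ENNReal.HolderConjugate.toReal_of_ne_top hp hq
    have := Real.inner_le_Lp_mul_Lq Finset.univ (fun j => a j) (fun j => b j) hc.symm
    rw [← lqNorm_rpow hpq.symm.one_le hq, ← lqNorm_rpow hpq.one_le hp] at this
    rw [← Real.rpow_mul (lqNorm_nonneg hpq.symm.one_le _),
      ← Real.rpow_mul (lqNorm_nonneg hpq.one_le _)] at this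
    simpa [hc.ne_zero, hc.symm.ne_zero] using this

/-- A unit vector of `ℓ₁` which attains the dual norm. -/
lemma exists_inner_eq_lqNorm_top {d : ℕ} (a : Vec d) :
    ∃ e : Vec d, lqNorm 1 e ≤ 1 ∧ inner ℝ a e = lqNorm ⊤ a := by
  rcases isEmpty_or_nonempty (Fin d) with hd | hd
  · refine ⟨0, by rw [lqNorm_zero le_rfl]; norm_num, ?_⟩
    have h1 : lqNorm ⊤ a ≤ 0 := lqNorm_top_le a le_rfl fun j => hd.elim j
    rw [le_antisymm h1 (lqNorm_nonneg le_top a), inner_zero_right]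
  · obtain ⟨k, hk⟩ := Finite.exists_max fun j => |a j|
    have hmax : lqNorm ⊤ a = |a k| :=
      le_antisymm (lqNorm_top_le a (abs_nonneg _) hk) (abs_apply_le_lqNorm le_top a k)
    refine ⟨EuclideanSpace.single k (SignType.sign (a k) : ℝ), ?_, ?_⟩
    · rw [lqNorm_one, Finset.sum_eq_single k]
      · rcases lt_trichotomy (a k) 0 with h | h | h <;> simp [h]
      · intro j _ hj
        simp [hj]
      · simp
    · rw [hmax, inner_eq_sum, Finset.sum_eq_single k]
      · simp
      · intro j _ hj
        simp [hj]
      · simp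

/-! ### First-order expansion of the cost on the convex domain -/

/-- The mean value theorem on a segment of a convex domain. -/
lemma exists_gradientWithin_eq_sub {d : ℕ} {𝒴 : Set (Vec d)} {g : Vec d → ℝ}
    (hconv : Convex ℝ 𝒴) (hg : DifferentiableOn ℝ g 𝒴) {y y' : Vec d} (hy : y ∈ 𝒴)
    (hy' : y' ∈ 𝒴) :
    ∃ z ∈ 𝒴, ‖z - y‖ ≤ ‖y' - y‖ ∧ g y' - g y = inner ℝ (gradientWithin g 𝒴 z) (y' - y) := by
  have hmaps : Set.MapsTo (fun t : ℝ => y + t • (y' - y)) (Set.Icc 0 1) 𝒴 := fun t ht =>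
    hconv.add_smul_sub_mem hy hy' ht
  have hderiv : ∀ t ∈ Set.Icc (0 : ℝ) 1, HasDerivWithinAt (fun t : ℝ => g (y + t • (y' - y)))
      (inner ℝ (gradientWithin g 𝒴 (y + t • (y' - y))) (y' - y)) (Set.Icc 0 1) t := by
    intro t ht
    have h1 := (hg _ (hmaps ht)).hasGradientWithinAt.hasFDerivWithinAt
    have h2 : HasDerivWithinAt (fun t : ℝ => y + t • (y' - y)) (y' - y) (Set.Icc 0 1) t := by
      simpa using (((hasDerivAt_id t).smul_const (y' - y)).const_add y).hasDerivWithinAt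
    exact h1.comp_hasDerivWithinAt t h2 hmaps
  obtain ⟨t, ht, h⟩ := exists_hasDerivAt_eq_slope (fun t : ℝ => g (y + t • (y' - y)))
    (fun t => inner ℝ (gradientWithin g 𝒴 (y + t • (y' - y))) (y' - y)) zero_lt_one
    (fun t ht => (hderiv t ht).continuousWithinAt)
    (fun t ht => (hderiv t (Set.Ioo_subset_Icc_self ht)).hasDerivAt (Icc_mem_nhds ht.1 ht.2))
  refine ⟨_, hmaps (Set.Ioo_subset_Icc_self ht), ?_, ?_⟩
  · rw [add_sub_cancel_left, norm_smul, Real.norm_eq_abs, abs_of_pos ht.1]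
    exact mul_le_of_le_one_left (norm_nonneg _) ht.2.le
  · simpa using h.symm

lemma RegularCost.exists_modulus {d : ℕ} {𝒴 : Set (Vec d)} {g : Vec d → ℝ}
    (hg : RegularCost 𝒴 g) {η : ℝ} (hη : 0 < η) :
    ∃ t₀ > 0, ∀ y₁ ∈ 𝒴, ∀ y₂ ∈ 𝒴, ‖y₁ - y₂‖ ≤ t₀ →
      ‖gradientWithin g 𝒴 y₁ - gradientWithin g 𝒴 y₂‖ ≤ η := by
  obtain ⟨κ, H, B, hκ, -, hB, hH⟩ := hg.holder
  have hlim : Tendsto (fun t : ℝ => (|B| + 1) * t ^ κ) (𝓝 0) (𝓝 0) := by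
    have := (Real.continuousAt_rpow_const 0 κ (Or.inr hκ.le)).tendsto.const_mul (|B| + 1)
    simpa [Real.zero_rpow hκ.ne'] using this
  obtain ⟨δ, hδ, hball⟩ := Metric.eventually_nhds_iff.1 (hlim.eventually (gt_mem_nhds hη))
  refine ⟨δ / 2, by positivity, fun y₁ h₁ y₂ h₂ h => (hH y₁ h₁ y₂ h₂).trans ?_⟩
  refine le_trans ?_ (hball (y := ‖y₁ - y₂‖) ?_).le
  · gcongr
    linarith [le_abs_self (H y₂), hB y₂ h₂, le_abs_self B]
  · rw [Real.dist_0_eq_abs, abs_of_nonneg (norm_nonneg _)]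
    linarith

/-- At interior points the gradient is the ordinary one and the Lipschitz constant bounds it. The
interior is dense in a convex set with nonempty interior, and uniform continuity of the gradient
carries the bound to the boundary. -/
lemma RegularCost.norm_gradientWithin_le {d : ℕ} {𝒴 : Set (Vec d)} {g : Vec d → ℝ}
    (hg : RegularCost 𝒴 g) (hconv : Convex ℝ 𝒴) (hint : (interior 𝒴).Nonempty) {L : ℝ≥0}
    (hL : LipschitzOnWith L g 𝒴) {y : Vec d} (hy : y ∈ 𝒴) : ‖gradientWithin g 𝒴 y‖ ≤ L := by
  have hin : ∀ u ∈ interior 𝒴, ‖gradientWithin g 𝒴 u‖ ≤ L := by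
    intro u hu
    have hnhds := mem_interior_iff_mem_nhds.1 hu
    rw [gradientWithin, LinearIsometryEquiv.norm_map, fderivWithin_of_mem_nhds hnhds]
    exact norm_fderiv_le_of_lipschitzOn ℝ hnhds hL
  refine le_of_forall_pos_le_add fun η hη => ?_
  obtain ⟨t₀, ht₀, hmod⟩ := hg.exists_modulus hη
  have hcl : y ∈ closure (interior 𝒴) := by
    rw [hconv.closure_interior_eq_closure_of_nonempty_interior hint]
    exact subset_closure hy
  obtain ⟨u, hu, hyu⟩ := Metric.mem_closure_iff.1 hcl t₀ ht₀
  have h1 := hmod y hy u (interior_subset hu) (by rw [← dist_eq_norm]; exact hyu.le)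
  have h2 := norm_sub_norm_le (gradientWithin g 𝒴 y) (gradientWithin g 𝒴 u)
  linarith [hin u hu]

/-- The mean value theorem gives a gradient at a point no further from `y` than `y'` is, so it
differs from the gradient at `y` by at most `η`. -/
lemma RegularCost.taylor_of_le {d : ℕ} {𝒴 : Set (Vec d)} {g : Vec d → ℝ}
    (hg : RegularCost 𝒴 g) (hconv : Convex ℝ 𝒴) {η t₀ : ℝ}
    (hmod : ∀ y₁ ∈ 𝒴, ∀ y₂ ∈ 𝒴, ‖y₁ - y₂‖ ≤ t₀ →
      ‖gradientWithin g 𝒴 y₁ - gradientWithin g 𝒴 y₂‖ ≤ η)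
    {y y' : Vec d} (hy : y ∈ 𝒴) (hy' : y' ∈ 𝒴) (h : ‖y' - y‖ ≤ t₀) :
    |g y' - g y - inner ℝ (gradientWithin g 𝒴 y) (y' - y)| ≤ η * ‖y' - y‖ := by
  obtain ⟨u, hu, huy, heq⟩ := exists_gradientWithin_eq_sub hconv hg.differentiable hy hy'
  rw [heq, ← inner_sub_left]
  refine (abs_real_inner_le_norm _ _).trans ?_
  gcongr
  exact hmod u hu y hy (huy.trans h)

/-- Beyond the distance `t₀` the Lipschitz bound `2 L t` is at most `2 L t ^ p / t₀ ^ (p - 1)`. The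
remainder then involves only the first and `p`-th powers of the displacement, both controlled by a
transport budget. -/
lemma RegularCost.taylor {d : ℕ} {𝒴 : Set (Vec d)} {g : Vec d → ℝ}
    (hg : RegularCost 𝒴 g) (hconv : Convex ℝ 𝒴) (hint : (interior 𝒴).Nonempty)
    {p : ℝ} (hp : 1 < p) {η : ℝ} (hη : 0 < η) :
    ∃ C ≥ 0, ∀ y ∈ 𝒴, ∀ y' ∈ 𝒴,
      |g y' - g y - inner ℝ (gradientWithin g 𝒴 y) (y' - y)| ≤
        η * ‖y' - y‖ + C * ‖y' - y‖ ^ p := by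
  obtain ⟨L, hL⟩ := hg.lipschitz
  obtain ⟨t₀, ht₀, hmod⟩ := hg.exists_modulus hη
  refine ⟨2 * L / t₀ ^ (p - 1), by positivity, fun y hy y' hy' => ?_⟩
  rcases le_total ‖y' - y‖ t₀ with h | h
  · exact (hg.taylor_of_le hconv hmod hy hy' h).trans (le_add_of_nonneg_right (by positivity))
  · have h1 : |g y' - g y - inner ℝ (gradientWithin g 𝒴 y) (y' - y)| ≤ 2 * L * ‖y' - y‖ := by
      have ha : |g y' - g y| ≤ L * ‖y' - y‖ := hL.norm_sub_le hy' hy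
      have hb : |inner ℝ (gradientWithin g 𝒴 y) (y' - y)| ≤ L * ‖y' - y‖ :=
        (abs_real_inner_le_norm _ _).trans
          (mul_le_mul_of_nonneg_right (hg.norm_gradientWithin_le hconv hint hL hy)
            (norm_nonneg _))
      linarith [abs_sub (g y' - g y) (inner ℝ (gradientWithin g 𝒴 y) (y' - y))]
    have hpos : 0 < ‖y' - y‖ := ht₀.trans_le h
    have h2 : 2 * L * ‖y' - y‖ ≤ 2 * L / t₀ ^ (p - 1) * ‖y' - y‖ ^ p := by
      have : ‖y' - y‖ ^ p = ‖y' - y‖ ^ (p - 1) * ‖y' - y‖ := by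
        rw [← Real.rpow_add_one hpos.ne', sub_add_cancel]
      rw [this, div_mul_eq_mul_div, le_div_iff₀ (by positivity)]
      have h3 : t₀ ^ (p - 1) ≤ ‖y' - y‖ ^ (p - 1) :=
        Real.rpow_le_rpow ht₀.le h (by linarith)
      nlinarith [mul_le_mul_of_nonneg_left h3 (by positivity : 0 ≤ 2 * (L : ℝ) * ‖y' - y‖)]
    linarith [mul_nonneg hη.le hpos.le]

/-- A ball around a point of a closed set stays inside it if it misses the frontier. -/
lemma closedBall_subset_of_notMem_cthickening {d : ℕ} {𝒴 : Set (Vec d)} (hclosed : IsClosed 𝒴)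
    {y : Vec d} (hy : y ∈ 𝒴) {t : ℝ} (ht : 0 ≤ t)
    (h : y ∉ Metric.cthickening t (frontier 𝒴)) : Metric.closedBall y t ⊆ 𝒴 := by
  have hmiss : ∀ u ∈ Metric.closedBall y t, u ∉ frontier 𝒴 := fun u hu hfr =>
    h (Metric.mem_cthickening_of_dist_le y u t _ hfr (by rw [dist_comm]; exact hu))
  have hcover : Metric.closedBall y t ⊆ interior 𝒴 ∪ 𝒴ᶜ := by
    intro u hu
    by_cases hu𝒴 : u ∈ 𝒴
    · left
      by_contra hni
      exact hmiss u hu ⟨subset_closure hu𝒴, hni⟩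
    · exact Or.inr hu𝒴
  have hyb : y ∈ Metric.closedBall y t := Metric.mem_closedBall_self ht
  have hyint : y ∈ interior 𝒴 := (hcover hyb).resolve_right fun hn => hn hy
  -- The ball is connected and covered by the disjoint open sets `interior 𝒴` and `𝒴ᶜ`, so it lies
  -- in the one that contains its centre.
  exact ((convex_closedBall y t).isPreconnected.subset_left_of_subset_union isOpen_interior
    hclosed.isOpen_compl (Set.disjoint_compl_right_iff_subset.2 interior_subset) hcover
    ⟨y, hyb, hyint⟩).trans interior_subset

/-! ### Couplings and the ambiguity set -/

/-- The slack `r' > r` avoids the question whether the infimum over couplings is attained; it is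
removed later by letting `r'` decrease to `r`. -/
lemma exists_coupling_of_wasserstein_le {d : ℕ} {p : ℝ≥0∞} (hp1 : 1 ≤ p) (hp : p ≠ ⊤)
    {μ₀ μ : Measure (Vec d)} [IsProbabilityMeasure μ] {r r' : ℝ} (hr : 0 ≤ r) (hrr' : r < r')
    (h : wasserstein p μ₀ μ ≤ ENNReal.ofReal r) :
    ∃ π : Measure (Vec d × Vec d), IsProbabilityMeasure π ∧ π.map Prod.fst = μ₀ ∧
      π.map Prod.snd = μ ∧
      Integrable (fun uv => lqNorm p (uv.2 - uv.1) ^ p.toReal) π ∧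
      ∫ uv, lqNorm p (uv.2 - uv.1) ^ p.toReal ∂π ≤ r' ^ p.toReal := by
  have hr' : 0 < r' := hr.trans_lt hrr'
  have hp0 : 0 < p.toReal := ENNReal.toReal_pos (by positivity) hp
  have hlt := h.trans_lt ((ENNReal.ofReal_lt_ofReal_iff hr').2 hrr')
  simp only [wasserstein, iInf_lt_iff] at hlt
  obtain ⟨π, h1, h2, h3⟩ := hlt
  have hπ : IsProbabilityMeasure π := by
    constructor
    have : μ Set.univ = 1 := measure_univ
    rwa [← h2, Measure.map_apply measurable_snd MeasurableSet.univ, Set.preimage_univ] at this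
  have hcont : Continuous fun uv : Vec d × Vec d => lqNorm p (uv.2 - uv.1) ^ p.toReal :=
    ((continuous_lqNorm hp1).comp (by fun_prop)).rpow_const fun _ => Or.inr hp0.le
  have hnn : ∀ uv : Vec d × Vec d, 0 ≤ lqNorm p (uv.2 - uv.1) ^ p.toReal := fun uv =>
    Real.rpow_nonneg (lqNorm_nonneg hp1 _) _
  have hcost : ∫⁻ uv, ENNReal.ofReal (lqNorm p (uv.2 - uv.1) ^ p.toReal) ∂π ≤
      ENNReal.ofReal (r' ^ p.toReal) := by
    have h4 := ENNReal.rpow_le_rpow h3.le hp0.le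
    rw [← ENNReal.rpow_mul, one_div, inv_mul_cancel₀ hp0.ne', ENNReal.rpow_one,
      ENNReal.ofReal_rpow_of_nonneg hr'.le hp0.le] at h4
    refine le_trans (le_of_eq (lintegral_congr fun uv => ?_)) h4
    rw [lqNorm_sub_comm hp1, ENNReal.ofReal_rpow_of_nonneg (lqNorm_nonneg hp1 _) hp0.le]
  have hint : Integrable (fun uv => lqNorm p (uv.2 - uv.1) ^ p.toReal) π := by
    refine ⟨hcont.aestronglyMeasurable, ?_⟩
    rw [hasFiniteIntegral_iff_ofReal (Eventually.of_forall hnn)]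
    exact hcost.trans_lt ENNReal.ofReal_lt_top
  refine ⟨π, hπ, h1, h2, hint, ?_⟩
  rw [← ofReal_integral_eq_lintegral_ofReal hint (Eventually.of_forall hnn)] at hcost
  exact (ENNReal.ofReal_le_ofReal_iff (by positivity)).1 hcost

lemma le_one_add_rpow {t p : ℝ} (ht : 0 ≤ t) (hp : 1 ≤ p) : t ≤ 1 + t ^ p := by
  rcases le_total t 1 with h | h
  · linarith [Real.rpow_nonneg ht p]
  · linarith [Real.self_le_rpow_of_one_le h hp]

/-- The mean of a nonnegative function is at most its mean of order `p`. -/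
lemma integral_le_of_integral_rpow_le {α : Type*} [MeasurableSpace α] {π : Measure α}
    [IsProbabilityMeasure π] {ρ : α → ℝ} (hρ : ∀ a, 0 ≤ ρ a) (hm : AEStronglyMeasurable ρ π)
    {p : ℝ} (hp : 1 ≤ p) (hint : Integrable (fun a => ρ a ^ p) π) {r : ℝ} (hr : 0 < r)
    (h : ∫ a, ρ a ^ p ∂π ≤ r ^ p) : Integrable ρ π ∧ ∫ a, ρ a ∂π ≤ r := by
  have hI : Integrable ρ π :=
    ((integrable_const (1 : ℝ)).add hint).mono' hm (Eventually.of_forall fun a => by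
      simpa [abs_of_nonneg (hρ a)] using le_one_add_rpow (hρ a) hp)
  refine ⟨hI, ?_⟩
  -- Jensen's inequality for `t ↦ t ^ p`.
  have hJ := (convexOn_rpow hp).map_integral_le (μ := π) (f := ρ)
    (Real.continuous_rpow_const (by linarith)).continuousOn isClosed_Ici
    (Eventually.of_forall hρ) hI hint
  exact (Real.rpow_le_rpow_iff (integral_nonneg hρ) hr.le (by linarith)).1 (hJ.trans h)

lemma weightedEmpirical_compl {d n : ℕ} (w : Fin n → ℝ) {ys : Fin n → Vec d}
    {𝒴 : Set (Vec d)} (hm : IsClosed 𝒴) (hys : ∀ i, ys i ∈ 𝒴) :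
    weightedEmpirical w ys 𝒴ᶜ = 0 := by
  simp [weightedEmpirical, hm.measurableSet.compl, hys]

lemma isProbabilityMeasure_weightedEmpirical {d n : ℕ} {w : Fin n → ℝ} (hw : ∀ i, 0 ≤ w i)
    (hsum : ∑ i, w i = 1) (ys : Fin n → Vec d) :
    IsProbabilityMeasure (weightedEmpirical w ys) := by
  constructor
  simp [weightedEmpirical, ← ENNReal.ofReal_sum_of_nonneg fun i _ => hw i, hsum]

lemma integrable_weightedEmpirical {d n : ℕ} (w : Fin n → ℝ) (ys : Fin n → Vec d)
    (g : Vec d → ℝ) : Integrable g (weightedEmpirical w ys) := by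
  refine integrable_finsetSum_measure.2 fun i _ => Integrable.smul_measure ?_ ENNReal.ofReal_ne_top
  exact integrable_dirac (by simp)

lemma integral_weightedEmpirical {d n : ℕ} {w : Fin n → ℝ} (hw : ∀ i, 0 ≤ w i)
    (ys : Fin n → Vec d) (g : Vec d → ℝ) :
    ∫ y, g y ∂(weightedEmpirical w ys) = ∑ i, w i * g (ys i) := by
  rw [weightedEmpirical, integral_finsetSum_measure fun i _ => Integrable.smul_measure
    (integrable_dirac (by simp)) ENNReal.ofReal_ne_top]
  simp [integral_smul_measure, hw]

lemma aestronglyMeasurable_of_continuousOn {d : ℕ} {𝒴 : Set (Vec d)} (hclosed : IsClosed 𝒴)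
    {g : Vec d → ℝ} (hg : ContinuousOn g 𝒴) {μ : Measure (Vec d)} (hμ : μ 𝒴ᶜ = 0) :
    AEStronglyMeasurable g μ := by
  have h := hg.aestronglyMeasurable (μ := μ) hclosed.measurableSet
  rwa [Measure.restrict_eq_self_of_ae_mem (mem_ae_iff.2 hμ)] at h

lemma map_transfer {α β : Type*} [MeasurableSpace α] [MeasurableSpace β] {π : Measure α}
    {φ : α → β} (hφ : Measurable φ) {ν : Measure β} (h : π.map φ = ν) {g : β → ℝ}
    (hg : AEStronglyMeasurable g ν) :
    AEStronglyMeasurable (fun a => g (φ a)) π ∧ ∫ b, g b ∂ν = ∫ a, g (φ a) ∂π ∧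
      (Integrable g ν ↔ Integrable (fun a => g (φ a)) π) := by
  subst h
  exact ⟨hg.comp_measurable hφ, integral_map hφ.aemeasurable hg,
    integrable_map_measure hg hφ.aemeasurable⟩

/-- Couplings of the nominal distribution with a distribution in the ambiguity set, with the
facts needed to compare expected costs. -/
lemma exists_coupling_of_mem_ambiguitySet {d n : ℕ} {p : ℝ≥0∞} (hp1 : 1 ≤ p) (hp : p ≠ ⊤)
    {𝒴 : Set (Vec d)} (hclosed : IsClosed 𝒴) {g : Vec d → ℝ} {L : ℝ≥0}
    (hL : LipschitzOnWith L g 𝒴) {w : Fin n → ℝ} (hw : ∀ i, 0 ≤ w i)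
    {ys : Fin n → Vec d} (hys : ∀ i, ys i ∈ 𝒴) {r r' : ℝ} (hr : 0 ≤ r) (hrr' : r < r')
    {μ : Measure (Vec d)} (hμ : μ ∈ ambiguitySet p 𝒴 (weightedEmpirical w ys) r) :
    Integrable g μ ∧ ∃ π : Measure (Vec d × Vec d), IsProbabilityMeasure π ∧
      π.map Prod.fst = weightedEmpirical w ys ∧ (∀ᵐ uv ∂π, uv.1 ∈ 𝒴 ∧ uv.2 ∈ 𝒴) ∧
      Integrable (fun uv => lqNorm p (uv.2 - uv.1) ^ p.toReal) π ∧
      ∫ uv, lqNorm p (uv.2 - uv.1) ^ p.toReal ∂π ≤ r' ^ p.toReal ∧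
      Integrable (fun uv => lqNorm p (uv.2 - uv.1)) π ∧
      ∫ uv, lqNorm p (uv.2 - uv.1) ∂π ≤ r' ∧
      Integrable (fun uv => g uv.2 - g uv.1) π ∧
      ∫ y, g y ∂μ = ∑ i, w i * g (ys i) + ∫ uv, (g uv.2 - g uv.1) ∂π := by
  obtain ⟨hprob, hμ𝒴, hW⟩ := hμ
  obtain ⟨π, hπ, hfst, hsnd, hint, hcost⟩ := exists_coupling_of_wasserstein_le hp1 hp hr hrr' hW
  have hp1' : 1 ≤ p.toReal := by simpa using ENNReal.toReal_mono hp hp1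
  have hmem : ∀ᵐ uv ∂π, uv.1 ∈ 𝒴 ∧ uv.2 ∈ 𝒴 := by
    have h1 : ∀ᵐ u ∂(π.map Prod.fst), u ∈ 𝒴 := by
      rw [hfst]
      exact mem_ae_iff.2 (weightedEmpirical_compl w hclosed hys)
    have h2 : ∀ᵐ u ∂(π.map Prod.snd), u ∈ 𝒴 := by
      rw [hsnd]
      exact mem_ae_iff.2 hμ𝒴
    exact (ae_of_ae_map measurable_fst.aemeasurable h1).and
      (ae_of_ae_map measurable_snd.aemeasurable h2)
  have hcont : Continuous fun uv : Vec d × Vec d => lqNorm p (uv.2 - uv.1) :=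
    (continuous_lqNorm hp1).comp (by fun_prop)
  have hmeas := hcont.aestronglyMeasurable (μ := π)
  have hmean : Integrable (fun uv : Vec d × Vec d => lqNorm p (uv.2 - uv.1)) π ∧
      ∫ uv, lqNorm p (uv.2 - uv.1) ∂π ≤ r' :=
    integral_le_of_integral_rpow_le (ρ := fun uv : Vec d × Vec d => lqNorm p (uv.2 - uv.1))
      (fun uv => lqNorm_nonneg hp1 (uv.2 - uv.1)) hmeas hp1' hint (hr.trans_lt hrr') hcost
  have hgμ : AEStronglyMeasurable g μ :=
    aestronglyMeasurable_of_continuousOn hclosed hL.continuousOn hμ𝒴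
  obtain ⟨-, e1, i1⟩ := map_transfer measurable_fst hfst
    (integrable_weightedEmpirical w ys g).aestronglyMeasurable
  obtain ⟨hgsndm, e2, i2⟩ := map_transfer measurable_snd hsnd hgμ
  have hgfst := i1.1 (integrable_weightedEmpirical w ys g)
  -- The increment is integrable by the Lipschitz bound, before anything is known about `g` under
  -- `μ`. Adding back `g` at the first coordinate, whose law is finitely supported, gives
  -- integrability of `g` under `μ`.
  have hdiff : Integrable (fun uv : Vec d × Vec d => g uv.2 - g uv.1) π := by
    refine (hmean.1.const_mul (L * d)).mono' (hgsndm.sub hgfst.aestronglyMeasurable) ?_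
    filter_upwards [hmem] with uv huv
    refine (hL.norm_sub_le huv.2 huv.1).trans ?_
    rw [mul_assoc]
    gcongr
    exact norm_le_mul_lqNorm hp1 _
  have hgsnd : Integrable (fun uv : Vec d × Vec d => g uv.2) π :=
    (hdiff.add hgfst).congr (Eventually.of_forall fun uv => by simp)
  refine ⟨i2.2 hgsnd, π, hπ, hfst, hmem, hint, hcost, hmean.1, hmean.2, hdiff, ?_⟩
  rw [integral_sub hgsnd hgfst, ← integral_weightedEmpirical hw, e1, e2]
  ring

/-- The mean displacement of a near-optimal coupling is at most `r'`. The choice `G = L * d` yields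
finiteness of the worst case, and the supremum of the gradient norm yields the sharp upper bound for
`p = 1`. -/
lemma integral_le_add_of_mem_ambiguitySet {d n : ℕ} {p : ℝ≥0∞} (hp1 : 1 ≤ p) (hp : p ≠ ⊤)
    {𝒴 : Set (Vec d)} (hclosed : IsClosed 𝒴) {g : Vec d → ℝ} {L : ℝ≥0}
    (hL : LipschitzOnWith L g 𝒴) {w : Fin n → ℝ} (hw : ∀ i, 0 ≤ w i)
    {ys : Fin n → Vec d} (hys : ∀ i, ys i ∈ 𝒴) {r : ℝ} (hr : 0 ≤ r)
    {μ : Measure (Vec d)} (hμ : μ ∈ ambiguitySet p 𝒴 (weightedEmpirical w ys) r)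
    {G : ℝ} (hG0 : 0 ≤ G)
    (hG : ∀ u ∈ 𝒴, ∀ v ∈ 𝒴, g v - g u ≤ G * lqNorm p (v - u)) :
    ∫ y, g y ∂μ ≤ ∑ i, w i * g (ys i) + r * G := by
  have key : ∀ r' > r, ∫ y, g y ∂μ ≤ ∑ i, w i * g (ys i) + r' * G := by
    intro r' hr'
    obtain ⟨-, π, hπ, -, hmem, -, -, hI, hle, hdiff, heq⟩ :=
      exists_coupling_of_mem_ambiguitySet hp1 hp hclosed hL hw hys hr hr' hμ
    rw [heq]
    gcongr
    calc ∫ uv, (g uv.2 - g uv.1) ∂π ≤ ∫ uv, G * lqNorm p (uv.2 - uv.1) ∂π := by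
          refine integral_mono_ae hdiff (hI.const_mul G) ?_
          filter_upwards [hmem] with uv huv using hG _ huv.1 _ huv.2
      _ ≤ r' * G := by
          rw [integral_const_mul, mul_comm]
          gcongr
  have hlim : Tendsto (fun r' => ∑ i, w i * g (ys i) + r' * G) (𝓝[>] r)
      (𝓝 (∑ i, w i * g (ys i) + r * G)) :=
    Tendsto.mono_left (Continuous.tendsto (by fun_prop) r) nhdsWithin_le_nhds
  exact ge_of_tendsto hlim (eventually_nhdsWithin_of_forall key)

lemma bddAbove_ballCosts {d n : ℕ} {p : ℝ≥0∞} (hp1 : 1 ≤ p) (hp : p ≠ ⊤)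
    {𝒴 : Set (Vec d)} (hclosed : IsClosed 𝒴) {g : Vec d → ℝ} {L : ℝ≥0}
    (hL : LipschitzOnWith L g 𝒴) {w : Fin n → ℝ} (hw : ∀ i, 0 ≤ w i)
    {ys : Fin n → Vec d} (hys : ∀ i, ys i ∈ 𝒴) {r : ℝ} (hr : 0 ≤ r) :
    BddAbove (ballCosts p 𝒴 (weightedEmpirical w ys) r g) := by
  refine ⟨∑ i, w i * g (ys i) + r * (L * d), ?_⟩
  rintro _ ⟨μ, hμ, rfl⟩
  refine integral_le_add_of_mem_ambiguitySet hp1 hp hclosed hL hw hys hr hμ (G := L * d)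
    (by positivity) fun u hu v hv => ?_
  refine (le_abs_self _).trans ((hL.norm_sub_le hv hu).trans ?_)
  rw [mul_assoc]
  gcongr
  exact norm_le_mul_lqNorm hp1 _

/-- Moving the atoms of the nominal distribution stays in the ambiguity set. -/
lemma weightedEmpirical_mem_ambiguitySet {d n : ℕ} {p : ℝ≥0∞} (hp1 : 1 ≤ p) (hp : p ≠ ⊤)
    {𝒴 : Set (Vec d)} (hclosed : IsClosed 𝒴) {w : Fin n → ℝ} (hw : ∀ i, 0 ≤ w i)
    (hsum : ∑ i, w i = 1) {ys ys' : Fin n → Vec d} (hys' : ∀ i, ys' i ∈ 𝒴) {r : ℝ} (hr : 0 ≤ r)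
    (hcost : ∑ i, w i * lqNorm p (ys' i - ys i) ^ p.toReal ≤ r ^ p.toReal) :
    weightedEmpirical w ys' ∈ ambiguitySet p 𝒴 (weightedEmpirical w ys) r := by
  have hp0 : 0 < p.toReal := ENNReal.toReal_pos (by positivity) hp
  refine ⟨isProbabilityMeasure_weightedEmpirical hw hsum ys',
    weightedEmpirical_compl w hclosed hys', ?_⟩
  refine iInf_le_of_le (∑ i, ENNReal.ofReal (w i) • Measure.dirac (ys i, ys' i)) ?_
  refine iInf_le_of_le ?_ (iInf_le_of_le ?_ ?_)
  · rw [Measure.map_finset_sum measurable_fst.aemeasurable]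
    simp [weightedEmpirical, Measure.map_smul, Measure.map_dirac]
  · rw [Measure.map_finset_sum measurable_snd.aemeasurable]
    simp [weightedEmpirical, Measure.map_smul, Measure.map_dirac]
  · have h : (∫⁻ uv, ENNReal.ofReal (lqNorm p (uv.1 - uv.2)) ^ p.toReal
        ∂(∑ i, ENNReal.ofReal (w i) • Measure.dirac (ys i, ys' i))) ≤
        ENNReal.ofReal (r ^ p.toReal) := by
      refine le_trans (le_of_eq ?_) (ENNReal.ofReal_le_ofReal hcost)
      rw [ENNReal.ofReal_sum_of_nonneg fun i _ =>
        mul_nonneg (hw i) (Real.rpow_nonneg (lqNorm_nonneg hp1 _) _)]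
      simp only [lintegral_finsetSum_measure, lintegral_smul_measure, lintegral_dirac]
      refine Finset.sum_congr rfl fun i _ => ?_
      rw [ENNReal.ofReal_mul (hw i), lqNorm_sub_comm hp1,
        ENNReal.ofReal_rpow_of_nonneg (lqNorm_nonneg hp1 _) hp0.le, smul_eq_mul]
    refine (ENNReal.rpow_le_rpow h (by positivity)).trans (le_of_eq ?_)
    rw [ENNReal.ofReal_rpow_of_nonneg (by positivity) (by positivity), ← Real.rpow_mul hr,
      one_div, mul_inv_cancel₀ hp0.ne', Real.rpow_one]

lemma nonempty_ballCosts {d n : ℕ} {p : ℝ≥0∞} (hp1 : 1 ≤ p) (hp : p ≠ ⊤)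
    {𝒴 : Set (Vec d)} (hclosed : IsClosed 𝒴) (g : Vec d → ℝ) {w : Fin n → ℝ} (hw : ∀ i, 0 ≤ w i)
    (hsum : ∑ i, w i = 1) {ys : Fin n → Vec d} (hys : ∀ i, ys i ∈ 𝒴) {r : ℝ} (hr : 0 ≤ r) :
    (ballCosts p 𝒴 (weightedEmpirical w ys) r g).Nonempty := by
  have hp0 : 0 < p.toReal := ENNReal.toReal_pos (by positivity) hp
  refine Set.Nonempty.image _ ⟨_, weightedEmpirical_mem_ambiguitySet hp1 hp hclosed hw hsum hys
    hr ?_⟩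
  simp only [sub_self, lqNorm_zero hp1, Real.zero_rpow hp0.ne', mul_zero, Finset.sum_const_zero]
  positivity

/-- Every lower bound on the worst case comes from this one: exhibit displaced atoms within the
transport budget. -/
lemma sum_le_worstCaseCost {d n : ℕ} {p : ℝ≥0∞} (hp1 : 1 ≤ p) (hp : p ≠ ⊤)
    {𝒴 : Set (Vec d)} (hclosed : IsClosed 𝒴) {g : Vec d → ℝ} {L : ℝ≥0}
    (hL : LipschitzOnWith L g 𝒴) {w : Fin n → ℝ} (hw : ∀ i, 0 ≤ w i) (hsum : ∑ i, w i = 1)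
    {ys ys' : Fin n → Vec d} (hys : ∀ i, ys i ∈ 𝒴) (hys' : ∀ i, ys' i ∈ 𝒴) {r : ℝ} (hr : 0 ≤ r)
    (hcost : ∑ i, w i * lqNorm p (ys' i - ys i) ^ p.toReal ≤ r ^ p.toReal) :
    ∑ i, w i * g (ys' i) ≤ worstCaseCost p 𝒴 (weightedEmpirical w ys) r g :=
  le_csSup (bddAbove_ballCosts hp1 hp hclosed hL hw hys hr)
    ⟨_, weightedEmpirical_mem_ambiguitySet hp1 hp hclosed hw hsum hys' hr hcost,
      integral_weightedEmpirical hw ys' g⟩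

/-! ### Deterministic expansion of the worst-case cost -/

lemma exists_forall_mul_rpow_le (C : ℝ) {p η : ℝ} (hp : 1 < p) (hη : 0 < η) :
    ∃ r₀ > 0, ∀ r, 0 < r → r < r₀ → C * r ^ p ≤ η * r := by
  have hlim : Tendsto (fun r : ℝ => C * r ^ (p - 1)) (𝓝 0) (𝓝 0) := by
    have := (Real.continuousAt_rpow_const 0 (p - 1) (Or.inr (by linarith))).tendsto.const_mul C
    simpa [Real.zero_rpow (by linarith : p - 1 ≠ 0)] using this
  obtain ⟨r₀, hr₀, h⟩ := Metric.eventually_nhds_iff.1 (hlim.eventually (gt_mem_nhds hη))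
  refine ⟨r₀, hr₀, fun r hr hrr => ?_⟩
  have h1 := h (y := r) (by rwa [Real.dist_0_eq_abs, abs_of_pos hr])
  have h2 : r ^ p = r ^ (p - 1) * r := by rw [← Real.rpow_add_one hr.ne', sub_add_cancel]
  rw [h2, ← mul_assoc]
  gcongr

lemma RegularCost.sub_le {d : ℕ} {p q : ℝ≥0∞} (hp : p ≠ ⊤) (hp1 : 1 < p)
    (hpq : ENNReal.HolderConjugate p q) {𝒴 : Set (Vec d)} (hconv : Convex ℝ 𝒴)
    (hint : (interior 𝒴).Nonempty) {g : Vec d → ℝ} (hg : RegularCost 𝒴 g) {η : ℝ} (hη : 0 < η) :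
    ∃ C ≥ 0, ∀ u ∈ 𝒴, ∀ v ∈ 𝒴, g v - g u ≤
      lqNorm q (gradientWithin g 𝒴 u) * lqNorm p (v - u) + η * lqNorm p (v - u) +
        C * lqNorm p (v - u) ^ p.toReal := by
  have hp1' : 1 < p.toReal := by
    simpa using (ENNReal.toReal_lt_toReal ENNReal.one_ne_top hp).2 hp1
  -- The division by `d + 1` absorbs the comparison `‖·‖ ≤ d ‖·‖_p`, and is harmless when `d = 0`.
  obtain ⟨C, hC, hT⟩ := hg.taylor hconv hint hp1' (η := η / (d + 1)) (by positivity)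
  refine ⟨C * d ^ p.toReal, by positivity, fun u hu v hv => ?_⟩
  have h1 := (abs_le.1 (hT u hu v hv)).2
  have h2 := inner_le_lqNorm_mul_lqNorm hp hpq (gradientWithin g 𝒴 u) (v - u)
  have h3 := norm_le_mul_lqNorm hp1.le (v - u)
  have h0 := lqNorm_nonneg hp1.le (v - u)
  have h4 : η / (d + 1) * ‖v - u‖ ≤ η * lqNorm p (v - u) := by
    calc η / (d + 1) * ‖v - u‖ ≤ η / (d + 1) * ((d + 1) * lqNorm p (v - u)) := by
          gcongr
          linarith
      _ = η * lqNorm p (v - u) := by field_simp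
  have h5 : C * ‖v - u‖ ^ p.toReal ≤ C * d ^ p.toReal * lqNorm p (v - u) ^ p.toReal := by
    rw [mul_assoc, ← Real.mul_rpow (by positivity) h0]
    gcongr
  linarith

/-- The upper bound on the worst-case cost for `1 < p`. -/
lemma exists_radius_integral_le {d : ℕ} {p q : ℝ≥0∞} (hp : p ≠ ⊤) (hp1 : 1 < p)
    (hpq : ENNReal.HolderConjugate p q) {𝒴 : Set (Vec d)} (hclosed : IsClosed 𝒴)
    (hconv : Convex ℝ 𝒴) (hint : (interior 𝒴).Nonempty) {g : Vec d → ℝ}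
    (hg : RegularCost 𝒴 g) {η : ℝ} (hη : 0 < η) :
    ∃ r₀ > 0, ∀ (n : ℕ) (w : Fin n → ℝ) (ys : Fin n → Vec d) (r : ℝ), (∀ i, 0 ≤ w i) →
      (∀ i, ys i ∈ 𝒴) → 0 < r → r < r₀ →
      ∀ μ ∈ ambiguitySet p 𝒴 (weightedEmpirical w ys) r,
        ∫ y, g y ∂μ ≤ ∑ i, w i * g (ys i) + r * gradNorm q 𝒴 w ys g + η * r := by
  obtain ⟨L, hL⟩ := hg.lipschitz
  obtain ⟨C, hC, hT⟩ := hg.sub_le hp hp1 hpq hconv hint (half_pos hη)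
  have hp1' : 1 < p.toReal := by
    simpa using (ENNReal.toReal_lt_toReal ENNReal.one_ne_top hp).2 hp1
  have hq : q ≠ ⊤ := by
    rintro rfl
    have := hpq.inv_add_inv_eq_one
    simp only [ENNReal.inv_top, add_zero] at this
    simp [ENNReal.inv_eq_one.1 this] at hp1
  have hc := ENNReal.HolderConjugate.toReal_of_ne_top hp hq
  have hq1 : 1 ≤ q := hpq.symm.one_le
  obtain ⟨r₀, hr₀, hsmall⟩ := exists_forall_mul_rpow_le C hp1' (half_pos hη)
  refine ⟨r₀, hr₀, fun n w ys r hw hys hr hrr μ hμ => ?_⟩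
  set N := gradNorm q 𝒴 w ys g with hN
  have key : ∀ r' > r, ∫ y, g y ∂μ ≤ ∑ i, w i * g (ys i) +
      (r' * N + η / 2 * r' + C * r' ^ p.toReal) := by
    intro r' hr'
    have hr'0 : 0 < r' := hr.trans hr'
    obtain ⟨-, π, hπ, hfst, hmem, hIp, hcost, hI, hle, hdiff, heq⟩ :=
      exists_coupling_of_mem_ambiguitySet hp1.le hp hclosed hL hw hys hr.le hr' hμ
    rw [heq]
    gcongr
    let F : Vec d → ℝ := fun u => lqNorm q (gradientWithin g 𝒴 u)
    have hF0 : ∀ u, 0 ≤ F u := fun u => lqNorm_nonneg hq1 _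
    have hρ0 : ∀ uv : Vec d × Vec d, 0 ≤ lqNorm p (uv.2 - uv.1) := fun uv =>
      lqNorm_nonneg hp1.le _
    -- No measurability of the gradient is required: under a finite sum of Dirac masses every real
    -- function is integrable.
    obtain ⟨hFm, -, -⟩ := map_transfer measurable_fst hfst
      (integrable_weightedEmpirical w ys F).aestronglyMeasurable
    obtain ⟨-, hFint, hFi⟩ := map_transfer measurable_fst hfst
      (integrable_weightedEmpirical w ys fun u => F u ^ q.toReal).aestronglyMeasurable
    have hFi' := hFi.1 (integrable_weightedEmpirical w ys _)
    have hFL : MemLp (fun uv : Vec d × Vec d => F uv.1) (ENNReal.ofReal q.toReal) π := by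
      rw [ENNReal.ofReal_toReal hq, ← integrable_norm_rpow_iff hFm (by positivity) hq]
      refine hFi'.congr (Eventually.of_forall fun uv => ?_)
      simp only [Real.norm_eq_abs, abs_of_nonneg (hF0 _)]
    have hρL : MemLp (fun uv : Vec d × Vec d => lqNorm p (uv.2 - uv.1))
        (ENNReal.ofReal p.toReal) π := by
      rw [ENNReal.ofReal_toReal hp,
        ← integrable_norm_rpow_iff hI.aestronglyMeasurable (by positivity) hp]
      refine hIp.congr (Eventually.of_forall fun uv => ?_)
      simp only [Real.norm_eq_abs, abs_of_nonneg (hρ0 _)]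
    have hholder := integral_mul_le_Lp_mul_Lq_of_nonneg hc.symm
      (Eventually.of_forall fun uv : Vec d × Vec d => hF0 uv.1) (Eventually.of_forall hρ0)
      hFL hρL
    have hprod : Integrable (fun uv : Vec d × Vec d => F uv.1 * lqNorm p (uv.2 - uv.1)) π := by
      have : ENNReal.HolderConjugate (ENNReal.ofReal q.toReal) (ENNReal.ofReal p.toReal) := by
        rw [ENNReal.ofReal_toReal hp, ENNReal.ofReal_toReal hq]
        exact hpq.symm
      exact hFL.integrable_mul hρL
    -- The gradient factor depends only on the first coordinate, whose law is the nominal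
    -- distribution, so its `L^q` norm is exactly `N`.
    have hNeq : (∫ uv, F uv.1 ^ q.toReal ∂π) ^ (1 / q.toReal) = N := by
      rw [← hFint, integral_weightedEmpirical hw, hN, gradNorm, if_neg hq]
    have hN0 : 0 ≤ N := by
      rw [← hNeq]
      exact Real.rpow_nonneg (integral_nonneg fun uv => Real.rpow_nonneg (hF0 _) _) _
    have hρroot : (∫ uv, lqNorm p (uv.2 - uv.1) ^ p.toReal ∂π) ^ (1 / p.toReal) ≤ r' := by
      refine (Real.rpow_le_rpow (integral_nonneg fun uv => Real.rpow_nonneg (hρ0 _) _) hcost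
        (by positivity)).trans (le_of_eq ?_)
      rw [← Real.rpow_mul hr'0.le, mul_one_div_cancel (by linarith), Real.rpow_one]
    rw [hNeq] at hholder
    have hpair : Integrable (fun uv : Vec d × Vec d => F uv.1 * lqNorm p (uv.2 - uv.1) +
        η / 2 * lqNorm p (uv.2 - uv.1)) π := hprod.add (hI.const_mul _)
    have hbound : Integrable (fun uv : Vec d × Vec d => F uv.1 * lqNorm p (uv.2 - uv.1) +
        η / 2 * lqNorm p (uv.2 - uv.1) + C * lqNorm p (uv.2 - uv.1) ^ p.toReal) π :=
      hpair.add (hIp.const_mul _)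
    calc ∫ uv, (g uv.2 - g uv.1) ∂π
        ≤ ∫ uv, (F uv.1 * lqNorm p (uv.2 - uv.1) + η / 2 * lqNorm p (uv.2 - uv.1) +
            C * lqNorm p (uv.2 - uv.1) ^ p.toReal) ∂π := by
          refine integral_mono_ae hdiff hbound ?_
          filter_upwards [hmem] with uv huv using hT _ huv.1 _ huv.2
      _ = ∫ uv, F uv.1 * lqNorm p (uv.2 - uv.1) ∂π + η / 2 * ∫ uv, lqNorm p (uv.2 - uv.1) ∂π +
            C * ∫ uv, lqNorm p (uv.2 - uv.1) ^ p.toReal ∂π := by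
          rw [integral_add hpair (hIp.const_mul _),
            integral_add hprod (hI.const_mul _), integral_const_mul, integral_const_mul]
      _ ≤ r' * N + η / 2 * r' + C * r' ^ p.toReal := by
          gcongr
          calc _ ≤ N * (∫ uv, lqNorm p (uv.2 - uv.1) ^ p.toReal ∂π) ^ (1 / p.toReal) := hholder
            _ ≤ N * r' := by gcongr
            _ = r' * N := mul_comm _ _
  have hlim : Tendsto (fun r' => ∑ i, w i * g (ys i) +
      (r' * N + η / 2 * r' + C * r' ^ p.toReal)) (𝓝[>] r)
      (𝓝 (∑ i, w i * g (ys i) + (r * N + η / 2 * r + C * r ^ p.toReal))) := by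
    refine Tendsto.mono_left ?_ nhdsWithin_le_nhds
    refine tendsto_const_nhds.add (Tendsto.add (Continuous.tendsto (by fun_prop) r) ?_)
    exact (Real.continuousAt_rpow_const r _ (Or.inl hr.ne')).tendsto.const_mul C
  have := ge_of_tendsto hlim (eventually_nhdsWithin_of_forall key)
  linarith [hsmall r hr hrr]

/-- A vector of `ℓ_p` dual to a given vector of `ℓ_q`. -/
lemma exists_dual_vector {d : ℕ} {p q : ℝ≥0∞} (hp : p ≠ ⊤) (hq : q ≠ ⊤)
    (hpq : ENNReal.HolderConjugate p q) (a : Vec d) :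
    ∃ v : Vec d, inner ℝ a v = lqNorm q a ^ q.toReal ∧
      lqNorm p v ^ p.toReal = lqNorm q a ^ q.toReal := by
  have hc := (ENNReal.HolderConjugate.toReal_of_ne_top hp hq).symm
  -- The equality case of Hölder's inequality; the `p`-norm comes out right because `(q - 1) p = q`.
  refine ⟨WithLp.toLp 2 fun j => (SignType.sign (a j) : ℝ) * |a j| ^ (q.toReal - 1), ?_, ?_⟩
  · rw [inner_eq_sum, lqNorm_rpow hpq.symm.one_le hq]
    refine Finset.sum_congr rfl fun j _ => ?_
    rcases eq_or_ne (a j) 0 with h | h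
    · simp [h, hc.ne_zero]
    · have h1 : |a j| ^ q.toReal = |a j| ^ (q.toReal - 1) * |a j| := by
        rw [← Real.rpow_add_one (abs_ne_zero.2 h), sub_add_cancel]
      simp only [h1]
      rw [← mul_assoc, mul_comm (a j), sign_mul_self, mul_comm]
  · rw [lqNorm_rpow hpq.one_le hp, lqNorm_rpow hpq.symm.one_le hq]
    refine Finset.sum_congr rfl fun j _ => ?_
    rcases eq_or_ne (a j) 0 with h | h
    · simp [h, hc.ne_zero, hc.symm.ne_zero]
    · have h1 : |(SignType.sign (a j) : ℝ)| = 1 := by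
        rcases lt_or_gt_of_ne h with h | h <;> simp [h]
      simp only [abs_mul, h1, one_mul]
      rw [abs_of_nonneg (by positivity), ← Real.rpow_mul (abs_nonneg _)]
      congr 1
      exact hc.sub_one_mul_conj

/-- The lower bound on the worst-case cost for `1 < p`. -/
lemma exists_radius_le_worstCaseCost {d : ℕ} {p q : ℝ≥0∞} (hp : p ≠ ⊤) (hq : q ≠ ⊤)
    (hpq : ENNReal.HolderConjugate p q) {𝒴 : Set (Vec d)} (hclosed : IsClosed 𝒴)
    (hconv : Convex ℝ 𝒴) (hint : (interior 𝒴).Nonempty) {g : Vec d → ℝ}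
    (hg : RegularCost 𝒴 g) {η : ℝ} (hη : 0 < η) :
    ∃ δ > 0, ∀ t > 0, ∃ r₀ > 0, ∀ (n : ℕ) (w : Fin n → ℝ) (ys : Fin n → Vec d) (r : ℝ)
      (S : Finset (Fin n)), (∀ i, 0 ≤ w i) → ∑ i, w i = 1 → (∀ i, ys i ∈ 𝒴) → 0 < r → r < r₀ →
      (∀ i ∈ S, Metric.closedBall (ys i) t ⊆ 𝒴) → ∑ i ∈ Sᶜ, w i ≤ δ →
      ∑ i, w i * g (ys i) + r * gradNorm q 𝒴 w ys g - η * r ≤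
        worstCaseCost p 𝒴 (weightedEmpirical w ys) r g := by
  obtain ⟨L, hL⟩ := hg.lipschitz
  have hc := (ENNReal.HolderConjugate.toReal_of_ne_top hp hq).symm
  have hp1 : 1 ≤ p := hpq.one_le
  have hq1 : 1 ≤ q := hpq.symm.one_le
  have hp0 : 0 < p.toReal := hc.symm.pos
  have hq0 : 0 < q.toReal := hc.pos
  have hgrad : ∀ y ∈ 𝒴, ‖gradientWithin g 𝒴 y‖ ≤ L := fun y hy =>
    hg.norm_gradientWithin_le hconv hint hL hy
  -- This bounds the Euclidean norm of the directions `V i` below: once `N > η`, `‖V i‖_p = (‖a i‖_q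
  -- / N) ^ (q / p)`, and `‖a i‖_q ≤ d * L`.
  set M : ℝ := d * ((d * L) / η) ^ (q.toReal / p.toReal) with hM
  have hM0 : 0 ≤ M := by positivity
  obtain ⟨t₀, ht₀, hmod⟩ := hg.exists_modulus (η := η / (2 * (M + 1))) (by positivity)
  -- The unmoved atoms lose at most `r * L * M * δ ≤ r * η / 2`. The bound on `r` keeps every
  -- displacement below both `t` and `t₀`.
  refine ⟨η / (2 * (L * M + 1)), by positivity, fun t ht => ⟨min t t₀ / (M + 1), by positivity, ?_⟩⟩
  intro n w ys r S hw hsum hys hr hrr hS hbad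
  set N := gradNorm q 𝒴 w ys g with hN
  set a : Fin n → Vec d := fun i => gradientWithin g 𝒴 (ys i) with ha
  have hNq : N ^ q.toReal = ∑ i, w i * lqNorm q (a i) ^ q.toReal := by
    rw [hN, gradNorm, if_neg hq, ← Real.rpow_mul, one_div_mul_cancel hq0.ne', Real.rpow_one]
    exact Finset.sum_nonneg fun i _ => mul_nonneg (hw i)
      (Real.rpow_nonneg (lqNorm_nonneg hq1 _) _)
  -- If `N ≤ η`, the nominal distribution itself is good enough; otherwise division by `N` is safe.
  rcases le_or_gt N η with hNη | hNη
  · have h1 := sum_le_worstCaseCost hp1 hp hclosed hL hw hsum hys hys hr.le (by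
      simp only [sub_self, lqNorm_zero hp1, Real.zero_rpow hp0.ne', mul_zero,
        Finset.sum_const_zero]
      positivity)
    nlinarith
  have hN0 : 0 < N := hη.trans hNη
  choose v hv1 hv2 using fun i => exists_dual_vector hp hq hpq (a i)
  -- With this scaling the weighted `p`-th moment of the `V i` is `1`, so displacements `r • V i`
  -- exhaust the budget, while the weighted sum of the pairings with the gradients is `N`.
  set V : Fin n → Vec d := fun i => N ^ (1 - q.toReal) • v i with hV
  have hVinner : ∀ i, inner ℝ (a i) (V i) =
      N ^ (1 - q.toReal) * lqNorm q (a i) ^ q.toReal := fun i => by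
    rw [hV, inner_smul_right, hv1]
  have hVnorm : ∀ i, lqNorm p (V i) ^ p.toReal = N ^ (-q.toReal) * lqNorm q (a i) ^ q.toReal := by
    intro i
    rw [hV, lqNorm_smul hp1, Real.mul_rpow (abs_nonneg _) (lqNorm_nonneg hp1 _), hv2,
      abs_of_pos (by positivity), ← Real.rpow_mul hN0.le]
    congr 2
    linarith [hc.sub_one_mul_conj]
  have hVle : ∀ i, ‖V i‖ ≤ M := by
    intro i
    refine (norm_le_mul_lqNorm hp1 _).trans ?_
    rw [hM]
    gcongr
    have ha' : lqNorm q (a i) ≤ d * L :=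
      (lqNorm_le_mul_norm hq1 _).trans (by gcongr; exact hgrad _ (hys i))
    have h1 : lqNorm p (V i) ^ p.toReal = (lqNorm q (a i) / N) ^ q.toReal := by
      rw [hVnorm, Real.div_rpow (lqNorm_nonneg hq1 _) hN0.le, Real.rpow_neg hN0.le]
      ring
    have h2 : lqNorm p (V i) = (lqNorm q (a i) / N) ^ (q.toReal / p.toReal) := by
      rw [div_eq_mul_inv q.toReal, Real.rpow_mul (div_nonneg (lqNorm_nonneg hq1 _) hN0.le), ← h1,
        Real.rpow_rpow_inv (lqNorm_nonneg hp1 _) hp0.ne']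
    rw [h2]
    have h3 : lqNorm q (a i) / N ≤ d * L / η := by gcongr
    exact Real.rpow_le_rpow (div_nonneg (lqNorm_nonneg hq1 _) hN0.le) h3 (by positivity)
  have hrM : r * M ≤ min t t₀ := by
    have h1 : r * (M + 1) < min t t₀ := by rwa [lt_div_iff₀ (by positivity)] at hrr
    linarith
  classical
  set ys' : Fin n → Vec d := fun i => if i ∈ S then ys i + r • V i else ys i with hys'
  have hrV : ∀ i, ‖r • V i‖ ≤ min t t₀ := fun i => by
    rw [norm_smul, Real.norm_eq_abs, abs_of_pos hr]
    exact (mul_le_mul_of_nonneg_left (hVle i) hr.le).trans hrM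
  have hmem' : ∀ i, ys' i ∈ 𝒴 := by
    intro i
    by_cases hi : i ∈ S
    · simp only [hys', if_pos hi]
      refine hS i hi ?_
      rw [mem_closedBall_iff_norm, add_sub_cancel_left]
      exact (hrV i).trans (min_le_left _ _)
    · simp only [hys', if_neg hi]
      exact hys i
  have hcost : ∑ i, w i * lqNorm p (ys' i - ys i) ^ p.toReal ≤ r ^ p.toReal := by
    calc ∑ i, w i * lqNorm p (ys' i - ys i) ^ p.toReal
        ≤ ∑ i, w i * (r ^ p.toReal * (N ^ (-q.toReal) * lqNorm q (a i) ^ q.toReal)) := by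
          refine Finset.sum_le_sum fun i _ => mul_le_mul_of_nonneg_left ?_ (hw i)
          rw [← hVnorm]
          by_cases hi : i ∈ S
          · simp only [hys', if_pos hi, add_sub_cancel_left]
            rw [lqNorm_smul hp1, abs_of_pos hr, Real.mul_rpow hr.le (lqNorm_nonneg hp1 _)]
          · simp only [hys', if_neg hi, sub_self, lqNorm_zero hp1, Real.zero_rpow hp0.ne']
            exact mul_nonneg (by positivity) (Real.rpow_nonneg (lqNorm_nonneg hp1 _) _)
      _ = r ^ p.toReal * (N ^ (-q.toReal) * N ^ q.toReal) := by
          rw [hNq, Finset.mul_sum, Finset.mul_sum]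
          exact Finset.sum_congr rfl fun i _ => by ring
      _ = r ^ p.toReal := by
          rw [← Real.rpow_add hN0, neg_add_cancel, Real.rpow_zero, mul_one]
  refine le_trans ?_ (sum_le_worstCaseCost hp1 hp hclosed hL hw hsum hys hmem' hr.le hcost)
  -- The ideal gain is written for all atoms, so that it sums to `r * N`. Moved atoms pay the Taylor
  -- error, unmoved ones give back their ideal gain, at most `r * w i * (L * M)`.
  have hgain : ∀ i, w i * g (ys i) + r * (w i * inner ℝ (a i) (V i)) -
      (w i * (r * η / 2) + if i ∈ S then 0 else r * (w i * (L * M))) ≤ w i * g (ys' i) := by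
    intro i
    have hin : inner ℝ (a i) (V i) ≤ L * M :=
      (real_inner_le_norm _ _).trans
        (mul_le_mul (hgrad _ (hys i)) (hVle i) (norm_nonneg _) L.coe_nonneg)
    by_cases hi : i ∈ S
    · have hT := hg.taylor_of_le hconv hmod (hys i) (hmem' i) (by
        simp only [hys', if_pos hi, add_sub_cancel_left]
        exact (hrV i).trans (min_le_right _ _))
      have h1 := (abs_le.1 hT).1
      simp only [hys', if_pos hi, add_sub_cancel_left, inner_smul_right] at h1 ⊢
      have h2 : η / (2 * (M + 1)) * ‖r • V i‖ ≤ r * η / 2 := by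
        rw [norm_smul, Real.norm_eq_abs, abs_of_pos hr, div_mul_eq_mul_div,
          div_le_div_iff₀ (by positivity) (by positivity)]
        nlinarith [hVle i, mul_pos hη hr,
          mul_le_mul_of_nonneg_left (hVle i) (mul_pos hη hr).le]
      have h3 : g (ys i) + r * inner ℝ (a i) (V i) - r * η / 2 ≤ g (ys i + r • V i) := by
        linarith
      have := mul_le_mul_of_nonneg_left h3 (hw i)
      linarith
    · simp only [hys', if_neg hi]
      have h1 := mul_le_mul_of_nonneg_left (mul_le_mul_of_nonneg_left hin (hw i)) hr.le
      have h2 : 0 ≤ w i * (r * η / 2) := mul_nonneg (hw i) (by positivity)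
      linarith
  have htot := Finset.sum_le_sum fun i (_ : i ∈ Finset.univ) => hgain i
  rw [Finset.sum_sub_distrib, Finset.sum_add_distrib, Finset.sum_add_distrib, ← Finset.sum_mul,
    hsum, ← Finset.mul_sum] at htot
  have hNsum : ∑ i, w i * inner ℝ (a i) (V i) = N := by
    calc ∑ i, w i * inner ℝ (a i) (V i)
        = N ^ (1 - q.toReal) * ∑ i, w i * lqNorm q (a i) ^ q.toReal := by
          rw [Finset.mul_sum]
          exact Finset.sum_congr rfl fun i _ => by rw [hVinner]; ring
      _ = N := by
          rw [← hNq, ← Real.rpow_add hN0, sub_add_cancel, Real.rpow_one]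
  have hbadsum : ∑ i, (if i ∈ S then 0 else r * (w i * (L * M))) ≤ r * η / 2 := by
    have h1 : ∑ i, (if i ∈ S then 0 else r * (w i * (L * M))) =
        r * (L * M) * ∑ i ∈ Sᶜ, w i := by
      rw [← Finset.sum_add_sum_compl S, Finset.sum_eq_zero fun i hi => if_pos hi, zero_add,
        Finset.mul_sum]
      refine Finset.sum_congr rfl fun i hi => ?_
      rw [if_neg (Finset.mem_compl.1 hi)]
      ring
    rw [h1]
    calc r * (L * M) * ∑ i ∈ Sᶜ, w i ≤ r * (L * M) * (η / (2 * (L * M + 1))) := by gcongr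
      _ ≤ r * η / 2 := by
        rw [mul_div_assoc', div_le_div_iff₀ (by positivity) (by positivity)]
        nlinarith [mul_pos hη hr, mul_nonneg L.coe_nonneg hM0]
  rw [hNsum] at htot
  linarith

/-- The lower bound on the worst-case cost for `p = 1`: mass near a point where the gradient is
large is moved in the direction of steepest ascent. -/
lemma RegularCost.le_worstCaseCost_one {d : ℕ} {𝒴 : Set (Vec d)} (hclosed : IsClosed 𝒴)
    (hconv : Convex ℝ 𝒴) {g : Vec d → ℝ} (hg : RegularCost 𝒴 g) {η t₀ : ℝ} (hη : 0 ≤ η)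
    (hmod : ∀ y₁ ∈ 𝒴, ∀ y₂ ∈ 𝒴, ‖y₁ - y₂‖ ≤ t₀ →
      ‖gradientWithin g 𝒴 y₁ - gradientWithin g 𝒴 y₂‖ ≤ η)
    {y : Vec d} (hy : y ∈ 𝒴) {n : ℕ} {w : Fin n → ℝ} {ys : Fin n → Vec d} {r t s : ℝ}
    {S : Finset (Fin n)} (hw : ∀ i, 0 ≤ w i) (hsum : ∑ i, w i = 1) (hys : ∀ i, ys i ∈ 𝒴)
    (hr : 0 < r) (hs : 0 < s) (hrs : r * d ≤ s * min t t₀)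
    (hS : ∀ i ∈ S, ‖ys i - y‖ ≤ t₀ ∧ Metric.closedBall (ys i) t ⊆ 𝒴) (hmass : s ≤ ∑ i ∈ S, w i) :
    ∑ i, w i * g (ys i) + r * (lqNorm ⊤ (gradientWithin g 𝒴 y) - 2 * d * η) ≤
      worstCaseCost 1 𝒴 (weightedEmpirical w ys) r g := by
  obtain ⟨L, hL⟩ := hg.lipschitz
  obtain ⟨e, he1, he⟩ := exists_inner_eq_lqNorm_top (gradientWithin g 𝒴 y)
  have hed : ‖e‖ ≤ d := (norm_le_mul_lqNorm le_rfl e).trans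
    (mul_le_of_le_one_right (Nat.cast_nonneg d) he1)
  -- The whole mass `W` moves by `(r / W) • e`, at cost at most `r`. Since `W ≥ s`, the step length
  -- is at most `r * d / s`.
  set W := ∑ i ∈ S, w i with hW
  have hW0 : 0 < W := hs.trans_le hmass
  have hstep : ‖(r / W) • e‖ ≤ min t t₀ := by
    rw [norm_smul, Real.norm_eq_abs, abs_of_pos (by positivity), div_mul_eq_mul_div,
      div_le_iff₀ hW0]
    have hmin : 0 ≤ min t t₀ := by
      have : 0 ≤ s * min t t₀ := le_trans (by positivity) hrs
      exact nonneg_of_mul_nonneg_right this hs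
    calc r * ‖e‖ ≤ r * d := by gcongr
      _ ≤ s * min t t₀ := hrs
      _ ≤ W * min t t₀ := by gcongr
      _ = min t t₀ * W := mul_comm _ _
  classical
  set ys' : Fin n → Vec d := fun i => if i ∈ S then ys i + (r / W) • e else ys i with hys'
  have hmem' : ∀ i, ys' i ∈ 𝒴 := by
    intro i
    by_cases hi : i ∈ S
    · simp only [hys', if_pos hi]
      refine (hS i hi).2 ?_
      rw [mem_closedBall_iff_norm, add_sub_cancel_left]
      exact hstep.trans (min_le_left _ _)
    · simp only [hys', if_neg hi]
      exact hys i
  have hcost : ∑ i, w i * lqNorm 1 (ys' i - ys i) ^ (1 : ℝ≥0∞).toReal ≤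
      r ^ (1 : ℝ≥0∞).toReal := by
    simp only [ENNReal.toReal_one, Real.rpow_one]
    rw [← Finset.sum_add_sum_compl S, Finset.sum_eq_zero (s := Sᶜ), add_zero]
    · calc ∑ i ∈ S, w i * lqNorm 1 (ys' i - ys i) ≤ ∑ i ∈ S, w i * (r / W) := by
            refine Finset.sum_le_sum fun i hi => mul_le_mul_of_nonneg_left ?_ (hw i)
            simp only [hys', if_pos hi, add_sub_cancel_left]
            rw [lqNorm_smul le_rfl, abs_of_pos (by positivity)]
            exact mul_le_of_le_one_right (by positivity) he1
        _ = r := by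
            rw [← Finset.sum_mul, ← hW]
            field_simp
    · intro i hi
      simp [hys', if_neg (Finset.mem_compl.1 hi), lqNorm_zero]
  refine le_trans ?_ (sum_le_worstCaseCost le_rfl ENNReal.one_ne_top hclosed hL hw hsum hys
    hmem' hr.le hcost)
  -- One `d * η` pays for replacing the gradient at `y` by that at `ys i`, the other for the Taylor
  -- remainder, both through `‖e‖ ≤ d`.
  have hgain : ∀ i ∈ S, w i * g (ys i) +
      w i * (r / W * (lqNorm ⊤ (gradientWithin g 𝒴 y) - 2 * d * η)) ≤ w i * g (ys' i) := by
    intro i hi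
    rw [← mul_add]
    refine mul_le_mul_of_nonneg_left ?_ (hw i)
    have hT := hg.taylor_of_le hconv hmod (hys i) (hmem' i) (by
      simp only [hys', if_pos hi, add_sub_cancel_left]
      exact hstep.trans (min_le_right _ _))
    have h1 := (abs_le.1 hT).1
    simp only [hys', if_pos hi, add_sub_cancel_left, inner_smul_right, norm_smul,
      Real.norm_eq_abs, abs_of_pos (show 0 < r / W by positivity)] at h1 ⊢
    have h2 : lqNorm ⊤ (gradientWithin g 𝒴 y) - d * η ≤
        inner ℝ (gradientWithin g 𝒴 (ys i)) e := by
      have h3 := (abs_le.1 (abs_real_inner_le_norm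
        (gradientWithin g 𝒴 (ys i) - gradientWithin g 𝒴 y) e)).1
      rw [inner_sub_left, he] at h3
      have h4 : ‖gradientWithin g 𝒴 (ys i) - gradientWithin g 𝒴 y‖ * ‖e‖ ≤ η * d := by
        gcongr
        exact hmod _ (hys i) _ hy (hS i hi).1
      linarith
    have h5 : η * (r / W * ‖e‖) ≤ r / W * (d * η) := by
      calc η * (r / W * ‖e‖) ≤ η * (r / W * d) := by gcongr
        _ = r / W * (d * η) := by ring
    have h6 := mul_le_mul_of_nonneg_left h2 (show 0 ≤ r / W by positivity)
    linarith
  rw [← Finset.sum_add_sum_compl S, ← Finset.sum_add_sum_compl S (fun i => w i * g (ys' i))]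
  have h1 := Finset.sum_le_sum hgain
  rw [Finset.sum_add_distrib, ← Finset.sum_mul, ← hW] at h1
  have h2 : ∑ i ∈ Sᶜ, w i * g (ys' i) = ∑ i ∈ Sᶜ, w i * g (ys i) :=
    Finset.sum_congr rfl fun i hi => by simp only [hys', if_neg (Finset.mem_compl.1 hi)]
  have h3 : W * (r / W * (lqNorm ⊤ (gradientWithin g 𝒴 y) - 2 * d * η)) =
      r * (lqNorm ⊤ (gradientWithin g 𝒴 y) - 2 * d * η) := by field_simp
  linarith

/-- The tolerated weight `δ` precedes the margin `t` because the margin is later chosen so that the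
conditional law puts little mass near the boundary, relative to `δ`. -/
lemma RegularCost.exists_regularizationError_le_of_one_lt {d : ℕ} {p q : ℝ≥0∞} (hp : p ≠ ⊤)
    (hp1 : 1 < p) (hpq : ENNReal.HolderConjugate p q) {𝒴 : Set (Vec d)} (hclosed : IsClosed 𝒴)
    (hconv : Convex ℝ 𝒴) (hint : (interior 𝒴).Nonempty) {g : Vec d → ℝ}
    (hg : RegularCost 𝒴 g) {η : ℝ} (hη : 0 < η) :
    ∃ δ > 0, ∀ t > 0, ∃ r₀ > 0, ∀ (n : ℕ) (w : Fin n → ℝ) (ys : Fin n → Vec d) (r : ℝ)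
      (S : Finset (Fin n)), (∀ i, 0 ≤ w i) → ∑ i, w i = 1 → (∀ i, ys i ∈ 𝒴) → 0 < r → r < r₀ →
      (∀ i ∈ S, Metric.closedBall (ys i) t ⊆ 𝒴) → ∑ i ∈ Sᶜ, w i ≤ δ →
      regularizationError p q 𝒴 w ys r g ≤ η * r := by
  have hq : q ≠ ⊤ := by
    rintro rfl
    have := hpq.inv_add_inv_eq_one
    simp only [ENNReal.inv_top, add_zero] at this
    simp [ENNReal.inv_eq_one.1 this] at hp1
  obtain ⟨r₁, hr₁, hup⟩ := exists_radius_integral_le hp hp1 hpq hclosed hconv hint hg hη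
  obtain ⟨δ, hδ, hlow⟩ := exists_radius_le_worstCaseCost hp hq hpq hclosed hconv hint hg hη
  refine ⟨δ, hδ, fun t ht => ?_⟩
  obtain ⟨r₂, hr₂, hlow⟩ := hlow t ht
  refine ⟨min r₁ r₂, lt_min hr₁ hr₂, fun n w ys r S hw hsum hys hr hrr hS hbad => ?_⟩
  have h1 := hlow n w ys r S hw hsum hys hr (hrr.trans_le (min_le_right _ _)) hS hbad
  have h2 : worstCaseCost p 𝒴 (weightedEmpirical w ys) r g ≤
      ∑ i, w i * g (ys i) + r * gradNorm q 𝒴 w ys g + η * r := by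
    refine csSup_le (nonempty_ballCosts hp1.le hp hclosed g hw hsum hys hr.le) ?_
    rintro _ ⟨μ, hμ, rfl⟩
    exact hup n w ys r hw hys hr (hrr.trans_le (min_le_left _ _)) μ hμ
  rw [regularizationError, integral_weightedEmpirical hw, abs_le]
  constructor <;> linarith

/-- Both the worst-case slope and the sample gradient norm are within `η` of the supremum of
`‖∇g‖_∞` over `𝒴`. The point `y` and the scale `t₀` come first, since the available weight `s` and
the margin `t` depend on them. -/
lemma RegularCost.exists_regularizationError_le_one {d : ℕ} {𝒴 : Set (Vec d)}
    (hclosed : IsClosed 𝒴) (hconv : Convex ℝ 𝒴) (hint : (interior 𝒴).Nonempty) {g : Vec d → ℝ}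
    (hg : RegularCost 𝒴 g) {η : ℝ} (hη : 0 < η) :
    ∃ y ∈ 𝒴, ∃ t₀ > 0, ∀ s > 0, ∀ t > 0, ∃ r₀ > 0, ∀ (n : ℕ) (w : Fin n → ℝ)
      (ys : Fin n → Vec d) (r : ℝ) (S : Finset (Fin n)), (∀ i, 0 ≤ w i) → ∑ i, w i = 1 →
      (∀ i, ys i ∈ 𝒴) → 0 < r → r < r₀ →
      (∀ i ∈ S, ‖ys i - y‖ ≤ t₀ ∧ Metric.closedBall (ys i) t ⊆ 𝒴) → s ≤ ∑ i ∈ S, w i →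
      regularizationError 1 ⊤ 𝒴 w ys r g ≤ η * r := by
  obtain ⟨L, hL⟩ := hg.lipschitz
  obtain ⟨t₀, ht₀, hmod⟩ := hg.exists_modulus (η := η / (4 * (d + 1))) (by positivity)
  set G : Vec d → ℝ := fun y => lqNorm ⊤ (gradientWithin g 𝒴 y) with hG
  have hbdd : BddAbove (G '' 𝒴) := by
    refine ⟨d * L, ?_⟩
    rintro _ ⟨y, hy, rfl⟩
    refine (lqNorm_le_mul_norm le_top _).trans ?_
    gcongr
    exact hg.norm_gradientWithin_le hconv hint hL hy
  have hne : (G '' 𝒴).Nonempty := (hint.mono interior_subset).image G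
  -- The supremum need not be attained; a point within `η / 2` of it suffices.
  obtain ⟨_, ⟨y, hy, rfl⟩, hyG⟩ := exists_lt_of_lt_csSup hne
    (sub_lt_self (sSup (G '' 𝒴)) (half_pos hη))
  have hGle : ∀ u ∈ 𝒴, G u ≤ sSup (G '' 𝒴) := fun u hu => le_csSup hbdd ⟨u, hu, rfl⟩
  refine ⟨y, hy, t₀, ht₀, fun s hs t ht => ⟨s * min t t₀ / (d + 1), by positivity, ?_⟩⟩
  intro n w ys r S hw hsum hys hr hrr hS hmass
  have hdη : 2 * d * (η / (4 * (d + 1))) ≤ η / 2 := by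
    rw [mul_div_assoc', div_le_div_iff₀ (by positivity) (by positivity)]
    nlinarith
  have hlow := hg.le_worstCaseCost_one hclosed hconv (by positivity) hmod hy hw hsum hys hr hs
    (by
      rw [lt_div_iff₀ (by positivity)] at hrr
      linarith) hS hmass
  have hup : worstCaseCost 1 𝒴 (weightedEmpirical w ys) r g ≤
      ∑ i, w i * g (ys i) + r * sSup (G '' 𝒴) := by
    refine csSup_le (nonempty_ballCosts le_rfl ENNReal.one_ne_top hclosed g hw hsum hys hr.le) ?_
    rintro _ ⟨μ, hμ, rfl⟩
    refine integral_le_add_of_mem_ambiguitySet le_rfl ENNReal.one_ne_top hclosed hL hw hys hr.le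
      hμ ((lqNorm_nonneg le_top _).trans (hGle y hy)) fun u hu v hv => ?_
    obtain ⟨u', hu', -, heq⟩ := exists_gradientWithin_eq_sub hconv hg.differentiable hu hv
    rw [heq]
    refine (inner_le_lqNorm_mul_lqNorm (q := ⊤) ENNReal.one_ne_top inferInstance _ _).trans ?_
    exact mul_le_mul_of_nonneg_right (hGle u' hu') (lqNorm_nonneg le_rfl _)
  have hnorm : gradNorm ⊤ 𝒴 w ys g = ⨆ i, G (ys i) := if_pos rfl
  have hN1 : gradNorm ⊤ 𝒴 w ys g ≤ sSup (G '' 𝒴) := by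
    rw [hnorm]
    exact Real.iSup_le (fun i => hGle _ (hys i)) ((lqNorm_nonneg le_top _).trans (hGle y hy))
  have hN2 : G y - η / 2 ≤ gradNorm ⊤ 𝒴 w ys g := by
    obtain ⟨i, hi⟩ : S.Nonempty := by
      rw [Finset.nonempty_iff_ne_empty]
      rintro rfl
      simp at hmass
      linarith
    have h1 : G y ≤ G (ys i) + η / 2 := by
      have h2 := lqNorm_add_le le_top (gradientWithin g 𝒴 (ys i))
        (gradientWithin g 𝒴 y - gradientWithin g 𝒴 (ys i))
      rw [add_sub_cancel] at h2
      have h3 : lqNorm ⊤ (gradientWithin g 𝒴 y - gradientWithin g 𝒴 (ys i)) ≤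
          d * (η / (4 * (d + 1))) := by
        refine (lqNorm_le_mul_norm le_top _).trans ?_
        gcongr
        exact hmod _ hy _ (hys i) (by rw [norm_sub_rev]; exact (hS i hi).1)
      have h4 : 0 ≤ d * (η / (4 * (d + 1))) := by positivity
      simp only [hG]
      linarith
    have h5 : G (ys i) ≤ ⨆ i, G (ys i) :=
      le_ciSup (f := fun i => G (ys i)) (Set.finite_range _).bddAbove i
    rw [hnorm]
    linarith
  rw [regularizationError, integral_weightedEmpirical hw, abs_le]
  have e1 := mul_le_mul_of_nonneg_left hN1 hr.le
  have e2 := mul_le_mul_of_nonneg_left hN2 hr.le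
  have e3 := mul_le_mul_of_nonneg_left hdη hr.le
  have e4 := mul_le_mul_of_nonneg_left hyG.le hr.le
  constructor <;> nlinarith

/-! ### An exponential inequality -/

/-- A Chernoff bound for i.i.d.-like bounded variables with negative mean and a variance of the
order of the mean. -/
lemma measureReal_sum_nonneg_le {Ω : Type*} [MeasurableSpace Ω] {P : Measure Ω}
    [IsProbabilityMeasure P] {Z : ℕ → Ω → ℝ} (hind : iIndepFun Z P)
    (hmeas : ∀ i, Measurable (Z i)) {B k τ v l : ℝ} (hB : ∀ i ω, |Z i ω| ≤ B)
    (hmean : ∀ i, ∫ ω, Z i ω ∂P = -(τ * k)) (hsq : ∀ i, ∫ ω, Z i ω ^ 2 ∂P ≤ v * k)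
    (hk : 0 ≤ k) (hl : 0 ≤ l) (hlB : l * B ≤ 1) (hlv : l * v ≤ τ / 2) (n : ℕ) :
    P.real {ω | 0 ≤ ∑ i ∈ Finset.range n, Z i ω} ≤ Real.exp (-(l * τ / 2 * (n * k))) := by
  have hlZ : ∀ i ω, |l * Z i ω| ≤ 1 := fun i ω => by
    rw [abs_mul, abs_of_nonneg hl]
    exact (mul_le_mul_of_nonneg_left (hB i ω) hl).trans hlB
  have hZint : ∀ i, Integrable (Z i) P := fun i =>
    Integrable.of_bound (hmeas i).aestronglyMeasurable B (Eventually.of_forall (hB i))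
  have hZsq : ∀ i, Integrable (fun ω => Z i ω ^ 2) P := fun i => by
    refine Integrable.of_bound ((hmeas i).pow_const 2).aestronglyMeasurable (B ^ 2)
      (Eventually.of_forall fun ω => ?_)
    rw [Real.norm_eq_abs, abs_pow]
    exact pow_le_pow_left₀ (abs_nonneg _) (hB i ω) 2
  have hexp : ∀ i, Integrable (fun ω => Real.exp (l * Z i ω)) P := fun i => by
    refine Integrable.of_bound ((hmeas i).const_mul l).exp.aestronglyMeasurable (Real.exp 1)
      (Eventually.of_forall fun ω => ?_)
    rw [Real.norm_eq_abs, Real.abs_exp]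
    exact Real.exp_le_exp.2 ((le_abs_self _).trans (hlZ i ω))
  have hmgf : ∀ i, mgf (Z i) P l ≤ Real.exp (-(l * τ / 2 * k)) := by
    intro i
    -- Uses `exp t ≤ 1 + t + t ^ 2` for `|t| ≤ 1`. The condition `l * v ≤ τ / 2` then lets the
    -- quadratic term eat at most half of the negative drift.
    calc mgf (Z i) P l ≤ ∫ ω, (1 + l * Z i ω + l ^ 2 * Z i ω ^ 2) ∂P := by
          refine integral_mono (hexp i) (((integrable_const _).add ((hZint i).const_mul l)).add
            ((hZsq i).const_mul _)) fun ω => ?_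
          have h := (abs_le.1 (Real.abs_exp_sub_one_sub_id_le (hlZ i ω))).2
          simp only [mul_pow] at h
          linarith
      _ = 1 + l * -(τ * k) + l ^ 2 * ∫ ω, Z i ω ^ 2 ∂P := by
          have h1 : Integrable (fun ω => 1 + l * Z i ω) P :=
            (integrable_const _).add ((hZint i).const_mul l)
          rw [integral_add h1 ((hZsq i).const_mul _), integral_add (integrable_const _)
            ((hZint i).const_mul l), integral_const_mul, integral_const_mul, hmean]
          simp
      _ ≤ 1 + -(l * τ / 2 * k) := by
          have h1 := mul_le_mul_of_nonneg_left (hsq i) (sq_nonneg l)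
          have h2 := mul_le_mul_of_nonneg_right hlv (mul_nonneg hl hk)
          nlinarith
      _ ≤ Real.exp (-(l * τ / 2 * k)) := by
          linarith [Real.add_one_le_exp (-(l * τ / 2 * k))]
  have hchern := measure_ge_le_exp_mul_mgf (μ := P) (X := ∑ i ∈ Finset.range n, Z i) 0 hl
    (hind.integrable_exp_mul_sum hmeas fun i _ => hexp i)
  rw [hind.mgf_sum hmeas] at hchern
  simp only [mul_zero, Real.exp_zero, one_mul, Finset.sum_apply] at hchern
  refine hchern.trans ((Finset.prod_le_prod (fun i _ => mgf_nonneg) fun i _ => hmgf i).trans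
    (le_of_eq ?_))
  rw [Finset.prod_const, Finset.card_range, ← Real.exp_nat_mul]
  congr 1
  ring

/-! ### Kernel mass around a point of the cube -/

lemma convex_unitCube (m : ℕ) : Convex ℝ (unitCube m) := by
  intro u hu v hv a b ha hb hab j
  have h1 := hu j
  have h2 := hv j
  simp only [PiLp.add_apply, PiLp.smul_apply, smul_eq_mul]
  constructor
  · nlinarith
  · nlinarith

lemma volume_unitCube_pos (m : ℕ) : 0 < (volume : Measure (Vec m)) (unitCube m) := by
  have hball : Metric.ball (WithLp.toLp 2 fun _ => 1 / 2 : Vec m) (1 / 2) ⊆ unitCube m := by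
    intro u hu j
    rw [mem_ball_iff_norm] at hu
    have h := (PiLp.norm_apply_le (u - WithLp.toLp 2 fun _ => 1 / 2 : Vec m) j).trans hu.le
    simp only [PiLp.sub_apply, Real.norm_eq_abs, abs_le] at h
    constructor <;> linarith
  exact (Metric.measure_ball_pos _ _ (by norm_num)).trans_le (measure_mono hball)

lemma norm_sub_le_of_mem_unitCube {m : ℕ} {u v : Vec m} (hu : u ∈ unitCube m)
    (hv : v ∈ unitCube m) : ‖u - v‖ ≤ m := by
  rw [← lqNorm_two]
  refine (lqNorm_le_sum_abs (by norm_num) _).trans ?_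
  calc ∑ j, |(u - v) j| ≤ ∑ _j : Fin m, (1 : ℝ) := Finset.sum_le_sum fun j _ => by
        rw [PiLp.sub_apply, abs_le]
        constructor <;> linarith [hu j, hv j, (hu j).1, (hv j).1, (hu j).2, (hv j).2]
    _ = m := by simp

/-- Small balls around a point of the cube fill a fixed proportion of it. -/
lemma exists_le_volume_unitCube_inter_closedBall {m : ℕ} {x : Vec m} (hx : x ∈ unitCube m) :
    ∃ c : ℝ, 0 < c ∧ ∀ ρ : ℝ, 0 < ρ → ρ ≤ 1 →
      ENNReal.ofReal (c * ρ ^ m) ≤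
        (volume : Measure (Vec m)) (unitCube m ∩ Metric.closedBall x ρ) := by
  obtain ⟨a, ha0, ha⟩ := ENNReal.lt_iff_exists_nnreal_btwn.1 (volume_unitCube_pos m)
  have ha0' : (0 : ℝ) < a := by exact_mod_cast ha0
  refine ⟨a / (m + 1) ^ m, by positivity, fun ρ hρ hρ1 => ?_⟩
  set s : ℝ := ρ / (m + 1) with hs
  have hs0 : 0 < s := by positivity
  have hs1 : s ≤ 1 := by
    rw [hs, div_le_one (by positivity)]
    linarith [(Nat.cast_nonneg m : (0 : ℝ) ≤ m)]
  -- Shrinking the cube towards `x` stays in the cube by convexity, and in the ball because the cube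
  -- has diameter at most `m`; the volume is multiplied by `s ^ m`.
  have hsub : AffineMap.homothety x s '' unitCube m ⊆ unitCube m ∩ Metric.closedBall x ρ := by
    rintro _ ⟨u, hu, rfl⟩
    rw [AffineMap.homothety_apply, vsub_eq_sub, vadd_eq_add]
    constructor
    · rw [add_comm]
      exact (convex_unitCube m).add_smul_sub_mem hx hu ⟨hs0.le, hs1⟩
    · rw [mem_closedBall_iff_norm, add_sub_cancel_right, norm_smul, Real.norm_eq_abs,
        abs_of_pos hs0]
      calc s * ‖u - x‖ ≤ s * (m + 1) := by
            gcongr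
            linarith [norm_sub_le_of_mem_unitCube hu hx]
        _ = ρ := by rw [hs]; field_simp
  refine le_trans ?_ (measure_mono hsub)
  rw [Measure.addHaar_image_homothety, finrank_euclideanSpace_fin, abs_of_pos (by positivity)]
  have h1 : a / (m + 1) ^ m * ρ ^ m = s ^ m * a := by
    rw [hs, div_pow]
    ring
  rw [h1, ENNReal.ofReal_mul (by positivity), ENNReal.ofReal_coe_nnreal]
  gcongr

lemma IsNWKernel.nonneg {m : ℕ} {K : Vec m → ℝ} (hK : IsNWKernel K) (u : Vec m) : 0 ≤ K u := by
  obtain ⟨r₁, r₂, b₁, b₂, -, -, hb₁, -, h⟩ := hK.bounds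
  refine le_trans ?_ (h u).1
  split_ifs <;> simp [hb₁.le]

/-- The mean kernel mass is at least of the order `h ^ m`. -/
lemma SamplingModel.exists_le_integral_kernel {Ω : Type*} [MeasurableSpace Ω] {P : Measure Ω}
    [IsProbabilityMeasure P] {m d : ℕ} {X : ℕ → Ω → Vec m} {ξ : ℕ → Ω → Vec d}
    {f : Vec m → Vec d} {μX : Measure (Vec m)} {μξ : Measure (Vec d)}
    (hmodel : SamplingModel P X ξ f μX μξ) {x : Vec m} (hx : x ∈ unitCube m) {K : Vec m → ℝ}
    (hK : IsNWKernel K) :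
    ∃ c h₀ : ℝ, 0 < c ∧ 0 < h₀ ∧ ∀ h : ℝ, 0 < h → h ≤ h₀ →
      c * h ^ m ≤ ∫ u, K (h⁻¹ • (x - u)) ∂μX := by
  have hprob : IsProbabilityMeasure μX := by
    rw [← hmodel.law_covariate 0]
    exact Measure.isProbabilityMeasure_map (hmodel.measurable_covariate 0).aemeasurable
  have hK0 := hK.nonneg
  obtain ⟨r₁, r₂, b₁, b₂, hr₁, hr₁₂, hb₁, hb₁₂, hKb⟩ := hK.bounds
  obtain ⟨b, hb, hbX⟩ := hmodel.covariate_lower_bound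
  obtain ⟨c, hc, hvol⟩ := exists_le_volume_unitCube_inter_closedBall hx
  -- The kernel is at least `b₁` on the ball of radius `r₁ * h`, and `h ≤ r₁⁻¹` makes this radius at
  -- most `1`.
  refine ⟨b₁ * (b * (c * r₁ ^ m)), r₁⁻¹, by positivity, by positivity, fun h hh hh₀ => ?_⟩
  have hball : b * (c * (r₁ * h) ^ m) ≤ μX.real (Metric.closedBall x (r₁ * h)) := by
    have h1 := hbX (Metric.closedBall x (r₁ * h))
    rw [Measure.smul_apply, Measure.restrict_apply Metric.isClosed_closedBall.measurableSet,
      Set.inter_comm, smul_eq_mul] at h1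
    have h2 := hvol (r₁ * h) (by positivity) (by
      calc r₁ * h ≤ r₁ * r₁⁻¹ := by gcongr
        _ = 1 := mul_inv_cancel₀ hr₁.ne')
    rw [measureReal_def, ← ENNReal.ofReal_le_iff_le_toReal (measure_ne_top _ _),
      ENNReal.ofReal_mul hb.le]
    exact le_trans (by gcongr) h1
  have hle : ∀ u, (Metric.closedBall x (r₁ * h)).indicator (fun _ => b₁) u ≤
      K (h⁻¹ • (x - u)) := by
    intro u
    by_cases hu : u ∈ Metric.closedBall x (r₁ * h)
    · rw [Set.indicator_of_mem hu]
      refine le_trans (le_of_eq ?_) (hKb _).1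
      rw [if_pos]
      rw [norm_smul, norm_inv, Real.norm_eq_abs, abs_of_pos hh, inv_mul_le_iff₀ hh, norm_sub_rev,
        mul_comm]
      exact mem_closedBall_iff_norm.1 hu
    · rw [Set.indicator_of_notMem hu]
      exact hK0 _
  have hint : Integrable (fun u => K (h⁻¹ • (x - u))) μX := by
    refine Integrable.of_bound (hK.measurable.comp (by fun_prop)).aestronglyMeasurable b₂
      (Eventually.of_forall fun u => ?_)
    rw [Real.norm_eq_abs, abs_of_nonneg (hK0 _)]
    refine (hKb _).2.trans ?_
    split_ifs <;> linarith
  calc b₁ * (b * (c * r₁ ^ m)) * h ^ m = b₁ * (b * (c * (r₁ * h) ^ m)) := by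
        rw [mul_pow]
        ring
    _ ≤ b₁ * μX.real (Metric.closedBall x (r₁ * h)) := by gcongr
    _ = ∫ u, (Metric.closedBall x (r₁ * h)).indicator (fun _ => b₁) u ∂μX := by
        rw [integral_indicator_const _ Metric.isClosed_closedBall.measurableSet, smul_eq_mul,
          mul_comm]
    _ ≤ ∫ u, K (h⁻¹ • (x - u)) ∂μX :=
        integral_mono ((integrable_const b₁).indicator Metric.isClosed_closedBall.measurableSet)
          hint hle

lemma nwWeight_nonneg {m n : ℕ} {K : Vec m → ℝ} (hK : IsNWKernel K) (h : ℝ) (x : Vec m)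
    (xs : Fin n → Vec m) (i : Fin n) : 0 ≤ nwWeight K h x xs i :=
  div_nonneg (hK.nonneg _) (Finset.sum_nonneg fun _ _ => hK.nonneg _)

lemma sum_nwWeight {m n : ℕ} {K : Vec m → ℝ} {h : ℝ} {x : Vec m} {xs : Fin n → Vec m}
    (hpos : 0 < kernelMass K h x xs) : ∑ i, nwWeight K h x xs i = 1 := by
  simp only [nwWeight]
  rw [← Finset.sum_div]
  exact div_self hpos.ne'

/-! ### Concentration of the Nadaraya-Watson weights -/

lemma SamplingModel.isProbabilityMeasure_noise {Ω : Type*} [MeasurableSpace Ω] {P : Measure Ω}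
    [IsProbabilityMeasure P] {m d : ℕ} {X : ℕ → Ω → Vec m} {ξ : ℕ → Ω → Vec d}
    {f : Vec m → Vec d} {μX : Measure (Vec m)} {μξ : Measure (Vec d)}
    (hmodel : SamplingModel P X ξ f μX μξ) : IsProbabilityMeasure μξ := by
  rw [← hmodel.law_noise 0]
  exact Measure.isProbabilityMeasure_map (hmodel.measurable_noise 0).aemeasurable

/-- With overwhelming probability, the Nadaraya-Watson weights are defined and the weighted
proportion of noises in a measurable set does not much exceed its probability. -/
lemma SamplingModel.exists_measure_weight_le {Ω : Type*} [MeasurableSpace Ω] {P : Measure Ω}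
    [IsProbabilityMeasure P] {m d : ℕ} {X : ℕ → Ω → Vec m} {ξ : ℕ → Ω → Vec d}
    {f : Vec m → Vec d} {μX : Measure (Vec m)} {μξ : Measure (Vec d)}
    (hmodel : SamplingModel P X ξ f μX μξ) {x : Vec m} (hx : x ∈ unitCube m) {K : Vec m → ℝ}
    (hK : IsNWKernel K) {h : ℕ → ℝ} (hpos : ∀ n, 0 < h n) (hzero : Tendsto h atTop (𝓝 0))
    {A : Set (Vec d)} (hA : MeasurableSet A) {τ : ℝ} (hτ : 0 < τ) :
    ∃ c > 0, ∀ᶠ n : ℕ in atTop,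
      P {ω | ¬ (0 < kernelMass K (h n) x (fun i : Fin n => X i ω) ∧
        ∑ i : Fin n, nwWeight K (h n) x (fun i : Fin n => X i ω) i *
          A.indicator (fun _ => (1 : ℝ)) (ξ i ω) < μξ.real A + τ)} ≤
        ENNReal.ofReal (Real.exp (-(c * (n * h n ^ m)))) := by
  have hprob := hmodel.isProbabilityMeasure_noise
  have hK0 := hK.nonneg
  obtain ⟨c₀, h₀, hc₀, hh₀, hmean⟩ := hmodel.exists_le_integral_kernel hx hK
  obtain ⟨r₁, r₂, b₁, b₂, hr₁, hr₁₂, hb₁, hb₁₂, hKb⟩ := hK.bounds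
  have hb₂ : 0 < b₂ := hb₁.trans_le hb₁₂
  have hKle : ∀ u, K u ≤ b₂ := fun u => (hKb u).2.trans (by split_ifs <;> linarith)
  set a := μξ.real A with ha
  have ha0 : 0 ≤ a := measureReal_nonneg
  have ha1 : a ≤ 1 := measureReal_le_one
  set B : ℝ := b₂ * (1 + τ) with hB
  set v : ℝ := b₂ * (1 + τ) ^ 2 with hv
  set l : ℝ := min B⁻¹ (τ / (2 * v)) with hl
  have hB0 : 0 < B := by positivity
  have hv0 : 0 < v := by positivity
  have hl0 : 0 < l := by positivity
  refine ⟨l * τ / 2 * c₀, by positivity, ?_⟩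
  filter_upwards [hzero.eventually (gt_mem_nhds hh₀)] with n hn
  set φ : Vec m → ℝ := fun u => K ((h n)⁻¹ • (x - u)) with hφ
  set ψ : Vec d → ℝ := fun e => A.indicator (fun _ => (1 : ℝ)) e - (a + τ) with hψ
  have hφm : Measurable φ := hK.measurable.comp (by fun_prop)
  have hψm : Measurable ψ := (measurable_const.indicator hA).sub_const _
  have hφ0 : ∀ u, 0 ≤ φ u := fun u => hK0 _
  have hφb : ∀ u, φ u ≤ b₂ := fun u => hKle _
  have hψb : ∀ e, |ψ e| ≤ 1 + τ := by
    intro e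
    rw [abs_le]
    by_cases he : e ∈ A
    · simp only [hψ, Set.indicator_of_mem he]
      constructor <;> linarith
    · simp only [hψ, Set.indicator_of_notMem he]
      constructor <;> linarith
  set k := ∫ u, φ u ∂μX with hk
  have hk0 : 0 ≤ k := integral_nonneg hφ0
  -- A ratio of sums is at least `a + τ` exactly when the sum of the `Z i` is nonnegative (for
  -- positive mass), so no separate control of the denominator is needed. By independence of noise
  -- and covariate, the mean of `Z i` is `-(τ * k)`.
  set Z : ℕ → Ω → ℝ := fun i ω => φ (X i ω) * ψ (ξ i ω) with hZ
  have hZm : ∀ i, Measurable (Z i) := fun i =>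
    (hφm.comp (hmodel.measurable_covariate i)).mul (hψm.comp (hmodel.measurable_noise i))
  have hind : iIndepFun Z P :=
    hmodel.indep_samples.comp (fun _ (z : Vec m × Vec d) => φ z.1 * ψ z.2) fun _ =>
      (hφm.comp measurable_fst).mul (hψm.comp measurable_snd)
  have hφk : ∀ i, ∫ ω, φ (X i ω) ∂P = k := fun i => by
    rw [hk, ← hmodel.law_covariate i]
    exact (integral_map (hmodel.measurable_covariate i).aemeasurable
      hφm.aestronglyMeasurable).symm
  have hψk : ∀ i, ∫ ω, ψ (ξ i ω) ∂P = -τ := fun i => by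
    rw [← integral_map (hmodel.measurable_noise i).aemeasurable
      hψm.aestronglyMeasurable, hmodel.law_noise i, hψ, integral_sub
      ((integrable_const _).indicator hA) (integrable_const _), integral_indicator_const _ hA]
    simp [ha]
  have hZmean : ∀ i, ∫ ω, Z i ω ∂P = -(τ * k) := fun i => by
    have h1 : IndepFun (fun ω => φ (X i ω)) (fun ω => ψ (ξ i ω)) P :=
      (hmodel.indep_noise i).comp hφm hψm
    have h2 := h1.integral_fun_mul_eq_mul_integral
      (hφm.comp (hmodel.measurable_covariate i)).aestronglyMeasurable
      (hψm.comp (hmodel.measurable_noise i)).aestronglyMeasurable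
    rw [hφk, hψk] at h2
    rw [hZ, h2]
    ring
  have hφint : ∀ i, Integrable (fun ω => φ (X i ω)) P := fun i =>
    Integrable.of_bound (hφm.comp (hmodel.measurable_covariate i)).aestronglyMeasurable b₂
      (Eventually.of_forall fun ω => by
        rw [Real.norm_eq_abs, abs_of_nonneg (hφ0 _)]
        exact hφb _)
  have hZB : ∀ i ω, |Z i ω| ≤ B := fun i ω => by
    rw [hZ, abs_mul, abs_of_nonneg (hφ0 _)]
    exact mul_le_mul (hφb _) (hψb _) (abs_nonneg _) hb₂.le
  have hZsqle : ∀ i ω, Z i ω ^ 2 ≤ v * φ (X i ω) := fun i ω => by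
    have h1 : ψ (ξ i ω) ^ 2 ≤ (1 + τ) ^ 2 := sq_le_sq' (abs_le.1 (hψb _)).1 (abs_le.1 (hψb _)).2
    calc Z i ω ^ 2 = φ (X i ω) * φ (X i ω) * ψ (ξ i ω) ^ 2 := by
          rw [hZ]
          ring
      _ ≤ φ (X i ω) * b₂ * (1 + τ) ^ 2 :=
          mul_le_mul (mul_le_mul_of_nonneg_left (hφb _) (hφ0 _)) h1 (sq_nonneg _)
            (mul_nonneg (hφ0 _) hb₂.le)
      _ = v * φ (X i ω) := by
          rw [hv]
          ring
  have hZsq : ∀ i, ∫ ω, Z i ω ^ 2 ∂P ≤ v * k := fun i => by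
    rw [← hφk i, ← integral_const_mul]
    exact integral_mono_of_nonneg (Eventually.of_forall fun ω => sq_nonneg _)
      ((hφint i).const_mul v) (Eventually.of_forall (hZsqle i))
  have hchern := measureReal_sum_nonneg_le hind hZm hZB hZmean hZsq hk0 hl0.le
    (by
      calc l * B ≤ B⁻¹ * B := by
            gcongr
            exact min_le_left _ _
        _ = 1 := inv_mul_cancel₀ hB0.ne')
    (by
      calc l * v ≤ τ / (2 * v) * v := by
            gcongr
            exact min_le_right _ _
        _ = τ / 2 := by field_simp) n
  have hsub : {ω | ¬ (0 < kernelMass K (h n) x (fun i : Fin n => X i ω) ∧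
        ∑ i : Fin n, nwWeight K (h n) x (fun i : Fin n => X i ω) i *
          A.indicator (fun _ => (1 : ℝ)) (ξ i ω) < a + τ)} ⊆
      {ω | 0 ≤ ∑ i ∈ Finset.range n, Z i ω} := by
    intro ω hω
    rw [Set.mem_ofPred_eq] at hω ⊢
    have hmass : kernelMass K (h n) x (fun i : Fin n => X i ω) = ∑ i : Fin n, φ (X i ω) := rfl
    have hsumZ : ∑ i ∈ Finset.range n, Z i ω =
        ∑ i : Fin n, φ (X i ω) * A.indicator (fun _ => (1 : ℝ)) (ξ i ω) -
          (a + τ) * ∑ i : Fin n, φ (X i ω) := by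
      rw [Finset.sum_range, Finset.mul_sum, ← Finset.sum_sub_distrib]
      exact Finset.sum_congr rfl fun i _ => by
        simp only [hZ, hψ]
        ring
    -- A vanishing kernel mass also makes the sum of the `Z i` nonnegative, so the same event covers
    -- undefined weights.
    rcases (Finset.sum_nonneg fun (i : Fin n) _ => hφ0 (X i ω)).eq_or_lt with h0 | h0
    · rw [hsumZ, ← h0, mul_zero, sub_zero]
      exact Finset.sum_nonneg fun i _ => mul_nonneg (hφ0 _)
        (Set.indicator_nonneg (fun _ _ => zero_le_one) _)
    · have h1 : a + τ ≤ ∑ i : Fin n, nwWeight K (h n) x (fun i : Fin n => X i ω) i *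
          A.indicator (fun _ => (1 : ℝ)) (ξ i ω) := by
        by_contra hcon
        exact hω ⟨hmass ▸ h0, not_le.1 hcon⟩
      have h2 : ∑ i : Fin n, nwWeight K (h n) x (fun i : Fin n => X i ω) i *
          A.indicator (fun _ => (1 : ℝ)) (ξ i ω) =
          (∑ i : Fin n, φ (X i ω) * A.indicator (fun _ => (1 : ℝ)) (ξ i ω)) /
            ∑ i : Fin n, φ (X i ω) := by
        rw [Finset.sum_div]
        refine Finset.sum_congr rfl fun i _ => ?_
        rw [nwWeight, hmass]
        ring
      rw [h2, le_div_iff₀ h0] at h1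
      linarith
  refine (measure_mono hsub).trans ?_
  rw [← ofReal_measureReal]
  refine ENNReal.ofReal_le_ofReal (hchern.trans (Real.exp_le_exp.2 (neg_le_neg ?_)))
  have h1 := hmean (h n) (hpos n) hn.le
  calc l * τ / 2 * c₀ * (n * h n ^ m) = l * τ / 2 * (n * (c₀ * h n ^ m)) := by ring
    _ ≤ l * τ / 2 * (n * k) := by gcongr

/-- The samples which carry weight are close to samples of the conditional law. -/
lemma SamplingModel.exists_measure_good_le {Ω : Type*} [MeasurableSpace Ω] {P : Measure Ω}
    [IsProbabilityMeasure P] {m d : ℕ} {X : ℕ → Ω → Vec m} {ξ : ℕ → Ω → Vec d}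
    {f : Vec m → Vec d} {μX : Measure (Vec m)} {μξ : Measure (Vec d)}
    (hmodel : SamplingModel P X ξ f μX μξ) {x : Vec m} (hx : x ∈ unitCube m) {K : Vec m → ℝ}
    (hK : IsNWKernel K) {h : ℕ → ℝ} (hpos : ∀ n, 0 < h n) (hzero : Tendsto h atTop (𝓝 0))
    {𝒴 : Set (Vec d)} (hmem : ∀ i, ∀ᵐ ω ∂P, f (X i ω) + ξ i ω ∈ 𝒴)
    {A : Set (Vec d)} (hA : MeasurableSet A) {τ θ : ℝ} (hτ : 0 < τ) (hθ : 0 < θ) :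
    ∃ c > 0, ∀ᶠ n : ℕ in atTop,
      P {ω | ¬ (0 < kernelMass K (h n) x (fun i : Fin n => X i ω) ∧
        (∀ i : Fin n, f (X i ω) + ξ i ω ∈ 𝒴) ∧
        ∀ S : Finset (Fin n), (∀ i ∉ S, ‖f (X i ω) + ξ i ω - (f x + ξ i ω)‖ ≤ θ → ξ i ω ∈ A) →
          ∑ i ∈ Sᶜ, nwWeight K (h n) x (fun i : Fin n => X i ω) i < μξ.real A + τ)} ≤
        ENNReal.ofReal (Real.exp (-(c * (n * h n ^ m)))) := by
  obtain ⟨c, hc, hev⟩ := hmodel.exists_measure_weight_le hx hK hpos hzero hA hτ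
  obtain ⟨L, hL⟩ := hmodel.lipschitz_regression
  obtain ⟨r₁, r₂, b₁, b₂, hr₁, hr₁₂, hb₁, hb₁₂, hKb⟩ := hK.bounds
  have hlim : Tendsto (fun n => L * (r₂ * h n)) atTop (𝓝 0) := by
    simpa using (hzero.const_mul r₂).const_mul (L : ℝ)
  have hcube : ∀ᵐ ω ∂P, ∀ i, X i ω ∈ unitCube m := by
    rw [ae_all_iff]
    intro i
    have h1 : ∀ᵐ u ∂(P.map (X i)), u ∈ unitCube m := by
      rw [hmodel.law_covariate i]
      exact mem_ae_iff.2 hmodel.covariate_mem_cube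
    exact ae_of_ae_map (hmodel.measurable_covariate i).aemeasurable h1
  refine ⟨c, hc, ?_⟩
  filter_upwards [hev, hlim.eventually (gt_mem_nhds hθ)] with n hn hnθ
  refine (measure_mono_ae ?_).trans hn
  filter_upwards [hcube, ae_all_iff.2 hmem] with ω hω hω𝒴 hbad hgood
  -- The set `S` is quantified inside the event, so it may later depend on the outcome, in
  -- particular on the positions of the samples.
  refine hbad ⟨hgood.1, fun i => hω𝒴 i, fun S hS => lt_of_le_of_lt ?_ hgood.2⟩
  have hw := nwWeight_nonneg hK (h n) x (fun i : Fin n => X i ω)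
  calc ∑ i ∈ Sᶜ, nwWeight K (h n) x (fun i : Fin n => X i ω) i
      ≤ ∑ i ∈ Sᶜ, nwWeight K (h n) x (fun i : Fin n => X i ω) i *
          A.indicator (fun _ => (1 : ℝ)) (ξ i ω) := by
        refine Finset.sum_le_sum fun i hi => ?_
        by_cases hKi : K ((h n)⁻¹ • (x - X i ω)) = 0
        · simp [nwWeight, hKi]
        · have hdist : ‖X i ω - x‖ ≤ r₂ * h n := by
            by_contra hcon
            refine hKi (le_antisymm ?_ (hK.nonneg _))
            refine (hKb _).2.trans (le_of_eq (if_neg ?_))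
            rw [norm_smul, norm_inv, Real.norm_eq_abs, abs_of_pos (hpos n),
              inv_mul_le_iff₀ (hpos n), norm_sub_rev, mul_comm]
            exact hcon
          have hclose : ‖f (X i ω) + ξ i ω - (f x + ξ i ω)‖ ≤ θ := by
            rw [add_sub_add_right_eq_sub]
            refine (hL.norm_sub_le (hω i) hx).trans (le_trans ?_ hnθ.le)
            gcongr
          rw [Set.indicator_of_mem (hS i (Finset.mem_compl.1 hi) hclose), mul_one]
    _ ≤ ∑ i : Fin n, nwWeight K (h n) x (fun i : Fin n => X i ω) i *
          A.indicator (fun _ => (1 : ℝ)) (ξ i ω) :=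
        Finset.sum_le_sum_of_subset_of_nonneg (Finset.subset_univ _) fun i _ _ =>
          mul_nonneg (hw i) (Set.indicator_nonneg (fun _ _ => zero_le_one) _)

/-! ### Weight near the boundary and near a point of the support -/

lemma measure_not_mono {Ω : Type*} [MeasurableSpace Ω] {P : Measure Ω} {E F : Ω → Prop}
    (h : ∀ ω, E ω → F ω) : P {ω | ¬ F ω} ≤ P {ω | ¬ E ω} := by
  refine measure_mono fun ω hω => ?_
  rw [Set.mem_ofPred_eq] at hω ⊢
  exact fun hE => hω (h ω hE)

lemma isProbabilityMeasure_condLaw {m d : ℕ} (f : Vec m → Vec d) (μξ : Measure (Vec d))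
    [IsProbabilityMeasure μξ] (x : Vec m) : IsProbabilityMeasure (condLaw f μξ x) :=
  Measure.isProbabilityMeasure_map (measurable_const_add _).aemeasurable

lemma condLaw_real_apply {m d : ℕ} (f : Vec m → Vec d) (μξ : Measure (Vec d)) (x : Vec m)
    {C : Set (Vec d)} (hC : MeasurableSet C) :
    (condLaw f μξ x).real C = μξ.real ((fun e => f x + e) ⁻¹' C) :=
  map_measureReal_apply (measurable_const_add _) hC

/-- Closed thickenings of a closed null set decrease to it. The factor `2` leaves room for the
distance between a sample and the corresponding sample of the conditional law. -/
lemma exists_measureReal_cthickening_lt {d : ℕ} {μ : Measure (Vec d)} [IsProbabilityMeasure μ]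
    {F : Set (Vec d)} (hF : IsClosed F) (h : μ F = 0) {δ t₁ : ℝ} (hδ : 0 < δ) (ht₁ : 0 < t₁) :
    ∃ t > 0, t ≤ t₁ ∧ μ.real (Metric.cthickening (2 * t) F) < δ := by
  have hlim := tendsto_measure_cthickening_of_isClosed (μ := μ)
    ⟨1, one_pos, measure_ne_top μ _⟩ hF
  rw [h] at hlim
  obtain ⟨r, hr, hball⟩ := Metric.eventually_nhds_iff.1
    (hlim.eventually (gt_mem_nhds (ENNReal.ofReal_pos.2 hδ)))
  refine ⟨min (r / 4) t₁, by positivity, min_le_right _ _, ?_⟩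
  have hpos : 0 < min (r / 4) t₁ := by positivity
  have h1 := hball (y := 2 * min (r / 4) t₁) (by
    rw [Real.dist_0_eq_abs, abs_of_pos (by positivity)]
    linarith [min_le_left (r / 4) t₁])
  rw [measureReal_def]
  exact (ENNReal.lt_ofReal_iff_toReal_lt (measure_ne_top _ _)).1 h1

lemma closedBall_subset_of_norm_sub_le {d : ℕ} {𝒴 : Set (Vec d)} (hclosed : IsClosed 𝒴)
    {y y₀ : Vec d} (hy : y ∈ 𝒴) {t : ℝ} (ht : 0 ≤ t) (hdist : ‖y - y₀‖ ≤ t)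
    (h : y₀ ∉ Metric.cthickening (2 * t) (frontier 𝒴)) : Metric.closedBall y t ⊆ 𝒴 := by
  refine closedBall_subset_of_notMem_cthickening hclosed hy ht fun hmem => h ?_
  have h1 : y₀ ∈ Metric.cthickening t (Metric.cthickening t (frontier 𝒴)) :=
    Metric.mem_cthickening_of_dist_le y₀ y t _ hmem (by rwa [dist_comm, dist_eq_norm])
  have h2 := Metric.cthickening_cthickening_subset ht ht _ h1
  rwa [← two_mul] at h2

section Model

variable {Ω : Type*} [MeasurableSpace Ω] {P : Measure Ω} [IsProbabilityMeasure P] {m d : ℕ}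
  {X : ℕ → Ω → Vec m} {ξ : ℕ → Ω → Vec d} {f : Vec m → Vec d} {μX : Measure (Vec m)}
  {μξ : Measure (Vec d)}

/-- With overwhelming probability, little weight is carried by samples close to the boundary. -/
lemma SamplingModel.exists_measure_interior_le (hmodel : SamplingModel P X ξ f μX μξ)
    {x : Vec m} (hx : x ∈ unitCube m) {K : Vec m → ℝ} (hK : IsNWKernel K) {h : ℕ → ℝ}
    (hpos : ∀ n, 0 < h n) (hzero : Tendsto h atTop (𝓝 0)) {𝒴 : Set (Vec d)}
    (hclosed : IsClosed 𝒴) (hmem : ∀ i, ∀ᵐ ω ∂P, f (X i ω) + ξ i ω ∈ 𝒴)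
    (hbdry : condLaw f μξ x (frontier 𝒴) = 0) {δ : ℝ} (hδ : 0 < δ) :
    ∃ t > 0, ∃ c > 0, ∀ᶠ n : ℕ in atTop,
      P {ω | ¬ (0 < kernelMass K (h n) x (fun i : Fin n => X i ω) ∧
        (∀ i : Fin n, f (X i ω) + ξ i ω ∈ 𝒴) ∧
        ∃ S : Finset (Fin n), (∀ i ∈ S, Metric.closedBall (f (X i ω) + ξ i ω) t ⊆ 𝒴) ∧
          ∑ i ∈ Sᶜ, nwWeight K (h n) x (fun i : Fin n => X i ω) i ≤ δ)} ≤
        ENNReal.ofReal (Real.exp (-(c * (n * h n ^ m)))) := by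
  have hprob := hmodel.isProbabilityMeasure_noise
  have hprob' := isProbabilityMeasure_condLaw f μξ x
  obtain ⟨t, ht, -, hthick⟩ := exists_measureReal_cthickening_lt isClosed_frontier hbdry
    (half_pos hδ) one_pos
  have hC : MeasurableSet (Metric.cthickening (2 * t) (frontier 𝒴)) :=
    Metric.isClosed_cthickening.measurableSet
  obtain ⟨c, hc, hev⟩ := hmodel.exists_measure_good_le hx hK hpos hzero hmem
    (measurable_const_add (f x) hC) (half_pos hδ) ht
  rw [condLaw_real_apply f μξ x hC] at hthick
  refine ⟨t, ht, c, hc, hev.mono fun n hn => (measure_not_mono fun ω hgood => ?_).trans hn⟩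
  classical
  refine ⟨hgood.1, hgood.2.1, Finset.univ.filter
    fun i : Fin n => Metric.closedBall (f (X i ω) + ξ i ω) t ⊆ 𝒴,
    fun i hi => (Finset.mem_filter.1 hi).2, ?_⟩
  -- A sample outside `S` that is within `t` of `f x + ξ i` forces the latter into the thickened
  -- frontier.
  refine le_trans (hgood.2.2 _ fun i hi hdist => ?_).le (by linarith)
  by_contra hcon
  exact hi (Finset.mem_filter.2 ⟨Finset.mem_univ _,
    closedBall_subset_of_norm_sub_le hclosed (hgood.2.1 i) ht.le hdist hcon⟩)

/-- With overwhelming probability, a fixed proportion of the weight is carried by samples close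
to a given point of the support, and away from the boundary. -/
lemma SamplingModel.exists_measure_near_le (hmodel : SamplingModel P X ξ f μX μξ)
    {x : Vec m} (hx : x ∈ unitCube m) {K : Vec m → ℝ} (hK : IsNWKernel K) {h : ℕ → ℝ}
    (hpos : ∀ n, 0 < h n) (hzero : Tendsto h atTop (𝓝 0)) {𝒴 : Set (Vec d)}
    (hclosed : IsClosed 𝒴) (hmem : ∀ i, ∀ᵐ ω ∂P, f (X i ω) + ξ i ω ∈ 𝒴)
    (hbdry : condLaw f μξ x (frontier 𝒴) = 0) {y : Vec d} (hy : y ∈ (condLaw f μξ x).support)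
    {t₀ : ℝ} (ht₀ : 0 < t₀) :
    ∃ s > 0, ∃ t > 0, ∃ c > 0, ∀ᶠ n : ℕ in atTop,
      P {ω | ¬ (0 < kernelMass K (h n) x (fun i : Fin n => X i ω) ∧
        (∀ i : Fin n, f (X i ω) + ξ i ω ∈ 𝒴) ∧
        ∃ S : Finset (Fin n), (∀ i ∈ S, ‖f (X i ω) + ξ i ω - y‖ ≤ t₀ ∧
            Metric.closedBall (f (X i ω) + ξ i ω) t ⊆ 𝒴) ∧
          s ≤ ∑ i ∈ S, nwWeight K (h n) x (fun i : Fin n => X i ω) i)} ≤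
        ENNReal.ofReal (Real.exp (-(c * (n * h n ^ m)))) := by
  have hprob := hmodel.isProbabilityMeasure_noise
  have hprob' := isProbabilityMeasure_condLaw f μξ x
  have hβ : 0 < (condLaw f μξ x).real (Metric.ball y (t₀ / 2)) :=
    ENNReal.toReal_pos ((Measure.mem_support_iff_forall y).1 hy _
      (Metric.ball_mem_nhds y (half_pos ht₀))).ne' (measure_ne_top _ _)
  set β := (condLaw f μξ x).real (Metric.ball y (t₀ / 2)) with hβdef
  obtain ⟨t, ht, htt₀, hthick⟩ := exists_measureReal_cthickening_lt isClosed_frontier hbdry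
    (half_pos hβ) (half_pos ht₀)
  -- The bad set: far from `y` or close to the frontier. It has conditional mass at most `1 - β /
  -- 2`, so with tolerance `β / 4` the good samples keep weight at least `β / 4`.
  set C := (Metric.ball y (t₀ / 2))ᶜ ∪ Metric.cthickening (2 * t) (frontier 𝒴) with hC
  have hCm : MeasurableSet C :=
    Metric.isOpen_ball.measurableSet.compl.union Metric.isClosed_cthickening.measurableSet
  have hCle : μξ.real ((fun e => f x + e) ⁻¹' C) ≤ 1 - β / 2 := by
    rw [← condLaw_real_apply f μξ x hCm, hC]
    refine (measureReal_union_le _ _).trans ?_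
    rw [measureReal_compl Metric.isOpen_ball.measurableSet, ← hβdef, probReal_univ]
    linarith
  obtain ⟨c, hc, hev⟩ := hmodel.exists_measure_good_le hx hK hpos hzero hmem
    (measurable_const_add (f x) hCm) (τ := β / 4) (by positivity) ht
  refine ⟨β / 4, by positivity, t, ht, c, hc,
    hev.mono fun n hn => (measure_not_mono fun ω hgood => ?_).trans hn⟩
  classical
  refine ⟨hgood.1, hgood.2.1, Finset.univ.filter
    fun i : Fin n => ‖f (X i ω) + ξ i ω - y‖ ≤ t₀ ∧
      Metric.closedBall (f (X i ω) + ξ i ω) t ⊆ 𝒴,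
    fun i hi => (Finset.mem_filter.1 hi).2, ?_⟩
  set S := Finset.univ.filter fun i : Fin n => ‖f (X i ω) + ξ i ω - y‖ ≤ t₀ ∧
      Metric.closedBall (f (X i ω) + ξ i ω) t ⊆ 𝒴 with hS
  have h1 := hgood.2.2 S fun i hi hdist => by
    by_contra hcon
    simp only [hC, Set.mem_preimage, Set.mem_union, Set.mem_compl_iff, not_or, not_not] at hcon
    refine hi (Finset.mem_filter.2 ⟨Finset.mem_univ _, ?_,
      closedBall_subset_of_norm_sub_le hclosed (hgood.2.1 i) ht.le hdist hcon.2⟩)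
    have h2 := mem_ball_iff_norm.1 hcon.1
    have h3 := norm_add_le (f (X i ω) + ξ i ω - (f x + ξ i ω)) (f x + ξ i ω - y)
    rw [sub_add_sub_cancel] at h3
    linarith
  have h2 := sum_nwWeight hgood.1
  rw [← Finset.sum_add_sum_compl S] at h2
  linarith

lemma tendsto_exp_neg_mul_atTop {h : ℕ → ℝ}
    (hband : Tendsto (fun n : ℕ => (n : ℝ) * h n ^ m) atTop atTop) {c : ℝ} (hc : 0 < c) :
    Tendsto (fun n : ℕ => ENNReal.ofReal (Real.exp (-(c * (n * h n ^ m))))) atTop (𝓝 0) := by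
  have h1 : Tendsto (fun n : ℕ => Real.exp (-(c * (n * h n ^ m)))) atTop (𝓝 0) :=
    Real.tendsto_exp_atBot.comp (tendsto_neg_atTop_atBot.comp (hband.const_mul_atTop hc))
  simpa using ENNReal.tendsto_ofReal h1

/-- For large `n` some outcome has a sample with a whole ball around it inside `𝒴`. This makes the
bound on the gradient within `𝒴` available. -/
lemma SamplingModel.nonempty_interior (hmodel : SamplingModel P X ξ f μX μξ)
    {x : Vec m} (hx : x ∈ unitCube m) {K : Vec m → ℝ} (hK : IsNWKernel K) {h : ℕ → ℝ}
    (hpos : ∀ n, 0 < h n) (hzero : Tendsto h atTop (𝓝 0))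
    (hband : Tendsto (fun n : ℕ => (n : ℝ) * h n ^ m) atTop atTop) {𝒴 : Set (Vec d)}
    (hclosed : IsClosed 𝒴) (hmem : ∀ i, ∀ᵐ ω ∂P, f (X i ω) + ξ i ω ∈ 𝒴)
    (hbdry : condLaw f μξ x (frontier 𝒴) = 0) : (interior 𝒴).Nonempty := by
  obtain ⟨t, ht, c, hc, hev⟩ := hmodel.exists_measure_interior_le hx hK hpos hzero hclosed hmem
    hbdry one_half_pos
  obtain ⟨n, hn, hlt⟩ := (hev.and ((tendsto_exp_neg_mul_atTop hband hc).eventually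
    (gt_mem_nhds one_pos))).exists
  have hne : ∃ ω, ω ∉ {ω | ¬ (0 < kernelMass K (h n) x (fun i : Fin n => X i ω) ∧
        (∀ i : Fin n, f (X i ω) + ξ i ω ∈ 𝒴) ∧
        ∃ S : Finset (Fin n), (∀ i ∈ S, Metric.closedBall (f (X i ω) + ξ i ω) t ⊆ 𝒴) ∧
          ∑ i ∈ Sᶜ, nwWeight K (h n) x (fun i : Fin n => X i ω) i ≤ 1 / 2)} := by
    by_contra hcon
    rw [Set.eq_univ_of_forall fun ω => not_not.1 (not_exists.1 hcon ω), measure_univ] at hn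
    exact absurd hlt (not_lt.2 hn)
  obtain ⟨ω, hω⟩ := hne
  obtain ⟨hmass, -, S, hS, hw⟩ := not_not.1 hω
  obtain ⟨i, hi⟩ : S.Nonempty := by
    rw [Finset.nonempty_iff_ne_empty]
    rintro rfl
    rw [Finset.compl_empty, sum_nwWeight hmass] at hw
    norm_num at hw
  exact ⟨f (X i ω) + ξ i ω, interior_mono (hS i hi)
    (Metric.ball_subset_interior_closedBall (Metric.mem_ball_self ht))⟩

/-- With overwhelming probability, the weights are defined and the approximation error is at most
a given small multiple of the radius. -/
lemma SamplingModel.exists_measure_error_le (hmodel : SamplingModel P X ξ f μX μξ)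
    {x : Vec m} (hx : x ∈ unitCube m) {K : Vec m → ℝ} (hK : IsNWKernel K) {h : ℕ → ℝ}
    (hpos : ∀ n, 0 < h n) (hzero : Tendsto h atTop (𝓝 0))
    (hband : Tendsto (fun n : ℕ => (n : ℝ) * h n ^ m) atTop atTop) {p q : ℝ≥0∞} (hp : p ≠ ⊤)
    (hpq : ENNReal.HolderConjugate p q) {𝒴 : Set (Vec d)} (hclosed : IsClosed 𝒴)
    (hconvex : Convex ℝ 𝒴) (hmem : ∀ i, ∀ᵐ ω ∂P, f (X i ω) + ξ i ω ∈ 𝒴)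
    (hbdry : condLaw f μξ x (frontier 𝒴) = 0)
    (hsupp : p = 1 → 𝒴 ⊆ (condLaw f μξ x).support) {ε : ℕ → ℝ} (hε : ∀ᶠ n in atTop, 0 < ε n)
    (hεzero : Tendsto ε atTop (𝓝 0)) {g : Vec d → ℝ} (hg : RegularCost 𝒴 g) {η : ℝ}
    (hη : 0 < η) :
    ∃ c > 0, ∀ᶠ n : ℕ in atTop,
      P {ω | ¬ (0 < kernelMass K (h n) x (fun i : Fin n => X i ω) ∧
        regularizationError p q 𝒴 (nwWeight K (h n) x (fun i : Fin n => X i ω))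
          (fun i : Fin n => f (X i ω) + ξ i ω) (ε n) g ≤ η * ε n)} ≤
        ENNReal.ofReal (Real.exp (-(c * (n * h n ^ m)))) := by
  have hint := hmodel.nonempty_interior hx hK hpos hzero hband hclosed hmem hbdry
  rcases hpq.one_le.eq_or_lt with rfl | hp1
  · have hq : q = ⊤ := by simpa using hpq.inv_add_inv_eq_one
    subst hq
    obtain ⟨y, hy, t₀, ht₀, hdet⟩ := hg.exists_regularizationError_le_one hclosed hconvex hint hη
    obtain ⟨s, hs, t, ht, c, hc, hev⟩ := hmodel.exists_measure_near_le hx hK hpos hzero hclosed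
      hmem hbdry (hsupp rfl hy) ht₀
    obtain ⟨r₀, hr₀, hdet⟩ := hdet s hs t ht
    refine ⟨c, hc, ?_⟩
    filter_upwards [hev, hε, hεzero.eventually (gt_mem_nhds hr₀)] with n hn hεn hεr
    refine (measure_not_mono fun ω hgood => ?_).trans hn
    obtain ⟨hmass, h𝒴, S, hS, hSw⟩ := hgood
    exact ⟨hmass, hdet n _ _ _ S (nwWeight_nonneg hK _ _ _) (sum_nwWeight hmass) h𝒴 hεn hεr hS hSw⟩
  · obtain ⟨δ, hδ, hdet⟩ := hg.exists_regularizationError_le_of_one_lt hp hp1 hpq hclosed hconvex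
      hint hη
    obtain ⟨t, ht, c, hc, hev⟩ := hmodel.exists_measure_interior_le hx hK hpos hzero hclosed
      hmem hbdry hδ
    obtain ⟨r₀, hr₀, hdet⟩ := hdet t ht
    refine ⟨c, hc, ?_⟩
    filter_upwards [hev, hε, hεzero.eventually (gt_mem_nhds hr₀)] with n hn hεn hεr
    refine (measure_not_mono fun ω hgood => ?_).trans hn
    obtain ⟨hmass, h𝒴, S, hS, hSw⟩ := hgood
    exact ⟨hmass, hdet n _ _ _ S (nwWeight_nonneg hK _ _ _) (sum_nwWeight hmass) h𝒴 hεn hεr hS hSw⟩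

end Model

/-! ### From exponential bounds to convergence -/

/-- A Borel-Cantelli lemma for events of probability exponentially small in a sequence of larger
order than the logarithm. -/
lemma ae_eventually_of_measure_compl_le {Ω : Type*} [MeasurableSpace Ω] {P : Measure Ω}
    [IsProbabilityMeasure P] {E : ℕ → Ω → Prop} {u : ℕ → ℝ} {c : ℝ} (hc : 0 < c)
    (hu : Tendsto (fun n : ℕ => u n / Real.log n) atTop atTop)
    (hE : ∀ᶠ n : ℕ in atTop, P {ω | ¬ E n ω} ≤ ENNReal.ofReal (Real.exp (-(c * u n)))) :
    ∀ᵐ ω ∂P, ∀ᶠ n in atTop, E n ω := by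
  have hsum : Summable fun n : ℕ => P.real {ω | ¬ E n ω} := by
    refine summable_of_isBigO_nat (g := fun n : ℕ => (n : ℝ) ^ (-2 : ℝ))
      (Real.summable_nat_rpow.2 (by norm_num)) ?_
    refine Asymptotics.IsBigO.of_bound 1 ?_
    -- Once `u n ≥ (2 / c) log n`, the exponential is at most `n ^ (-2)`.
    filter_upwards [hE, hu.eventually_ge_atTop (2 / c), eventually_ge_atTop 2] with n hn hun hn2
    have hn0 : (1 : ℝ) < n := by exact_mod_cast hn2
    have hlog : 0 < Real.log n := Real.log_pos hn0
    rw [Real.norm_of_nonneg measureReal_nonneg, Real.norm_of_nonneg (by positivity), one_mul]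
    refine (ENNReal.toReal_le_of_le_ofReal (Real.exp_nonneg _) hn).trans ?_
    rw [Real.rpow_def_of_pos (by linarith)]
    refine Real.exp_le_exp.2 ?_
    rw [div_le_div_iff₀ hc hlog] at hun
    linarith
  have htsum : ∑' n, P {ω | ¬ E n ω} ≠ ⊤ := by
    have h1 : ∀ n, ENNReal.ofReal (P.real {ω | ¬ E n ω}) = P {ω | ¬ E n ω} := fun n =>
      ofReal_measureReal (measure_ne_top _ _)
    exact (tsum_congr h1) ▸ hsum.tsum_ofReal_ne_top
  filter_upwards [ae_eventually_notMem htsum] with ω hω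
  exact hω.mono fun n hn => not_not.1 hn

lemma radius_pos {c₁ c₂ : ℝ} (hc₂ : 0 < c₂) {n : ℕ} (hn : 0 < n) {α : ℝ} (hα : 0 < α)
    (hαc : α < c₁) : 0 < radius c₁ c₂ n α := by
  have h1 : 0 < Real.log (c₁ / α) := Real.log_pos ((one_lt_div hα).2 hαc)
  have h2 : (0 : ℝ) < n := by exact_mod_cast hn
  exact Real.sqrt_pos.2 (by positivity)

end NWDRO

theorem mainTheorem6
    {Ω : Type*} [MeasurableSpace Ω] (P : Measure Ω) [IsProbabilityMeasure P]
    {m d : ℕ} (X : ℕ → Ω → NWDRO.Vec m) (ξ : ℕ → Ω → NWDRO.Vec d)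
    (f : NWDRO.Vec m → NWDRO.Vec d)
    (μX : Measure (NWDRO.Vec m)) (μξ : Measure (NWDRO.Vec d))
    (hmodel : NWDRO.SamplingModel P X ξ f μX μξ)
    (x : NWDRO.Vec m) (hx : x ∈ NWDRO.unitCube m)
    -- the kernel and the bandwidths
    (K : NWDRO.Vec m → ℝ) (hK : NWDRO.IsNWKernel K)
    (h : ℕ → ℝ) (hpos : ∀ n, 0 < h n) (hzero : Tendsto h atTop (𝓝 0))
    (hband : Tendsto (fun n : ℕ => (n : ℝ) * h n ^ m) atTop atTop)
    -- the type of the Wasserstein distance and its conjugate exponent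
    (p q : ℝ≥0∞) (hp : p ≠ ⊤) (hpq : ENNReal.HolderConjugate p q)
    -- the domain of the outcome
    (𝒴 : Set (NWDRO.Vec d)) (hclosed : IsClosed 𝒴) (hconvex : Convex ℝ 𝒴)
    (hmem : ∀ i, ∀ᵐ ω ∂P, f (X i ω) + ξ i ω ∈ 𝒴)
    (hbdry : NWDRO.condLaw f μξ x (frontier 𝒴) = 0)
    (hsupp : p = 1 → 𝒴 ⊆ (NWDRO.condLaw f μξ x).support)
    -- the radii
    (c₁ c₂ : ℝ) (hc₂ : 0 < c₂) (α : ℕ → ℝ) (hα : ∀ n, 0 < α n ∧ α n < c₁)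
    (hradius : Tendsto (fun n => NWDRO.radius c₁ c₂ n (α n)) atTop (𝓝 0))
    -- the cost function
    {Z : Type*} (c : Z → NWDRO.Vec d → ℝ) (z : Z) (hc : NWDRO.RegularCost 𝒴 (c z)) :
    let xs : (n : ℕ) → Ω → Fin n → NWDRO.Vec m := fun _ ω i => X i ω
    let ys : (n : ℕ) → Ω → Fin n → NWDRO.Vec d := fun _ ω i => f (X i ω) + ξ i ω
    let w : (n : ℕ) → Ω → Fin n → ℝ := fun n ω => NWDRO.nwWeight K (h n) x (xs n ω)
    let ε : ℕ → ℝ := fun n => NWDRO.radius c₁ c₂ n (α n)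
    let err : ℕ → Ω → ℝ := fun n ω =>
      NWDRO.regularizationError p q 𝒴 (w n ω) (ys n ω) (ε n) (c z)
    -- the worst-case cost is a finite supremum whenever the weights are defined
    (∀ᵐ ω ∂P, ∀ n, 0 < NWDRO.kernelMass K (h n) x (xs n ω) →
      (∀ μ ∈ NWDRO.ambiguitySet p 𝒴 (NWDRO.weightedEmpirical (w n ω) (ys n ω)) (ε n),
        Integrable (c z) μ) ∧
      (NWDRO.ballCosts p 𝒴 (NWDRO.weightedEmpirical (w n ω) (ys n ω)) (ε n) (c z)).Nonempty ∧
      BddAbove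
        (NWDRO.ballCosts p 𝒴 (NWDRO.weightedEmpirical (w n ω) (ys n ω)) (ε n) (c z))) ∧
    -- the weights are defined with probability tending to one
    Tendsto (fun n => P {ω | 0 < NWDRO.kernelMass K (h n) x (xs n ω)}) atTop (𝓝 1) ∧
    -- the approximation error is of smaller order than the radius, in probability
    NWDRO.IsLittleOInProb P err ε ∧
    -- and almost surely, if the bandwidths do not shrink too fast
    (Tendsto (fun n : ℕ => (n : ℝ) * h n ^ m / Real.log n) atTop atTop →
      ∀ᵐ ω ∂P, (∀ᶠ n in atTop, 0 < NWDRO.kernelMass K (h n) x (xs n ω)) ∧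
        Tendsto (fun n => err n ω / ε n) atTop (𝓝 0)) := by
  intro xs ys w ε err
  have hp1 : 1 ≤ p := hpq.one_le
  -- Only eventually: at `n = 0` the division by zero makes the radius `0`.
  have hεpos : ∀ᶠ n in atTop, 0 < ε n :=
    (eventually_gt_atTop 0).mono fun n hn => NWDRO.radius_pos hc₂ hn (hα n).1 (hα n).2
  have herr : ∀ n ω, |err n ω| = err n ω := fun _ _ => abs_abs _
  have hmain := fun (η : ℝ) (hη : 0 < η) =>
    hmodel.exists_measure_error_le hx hK hpos hzero hband hp hpq hclosed hconvex hmem hbdry hsupp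
      hεpos hradius hc hη
  refine ⟨?_, ?_, ?_, ?_⟩
  · filter_upwards [ae_all_iff.2 hmem] with ω hω n hmass
    obtain ⟨L, hL⟩ := hc.lipschitz
    have hw : ∀ i, 0 ≤ w n ω i := NWDRO.nwWeight_nonneg hK _ _ _
    have hε0 : 0 ≤ ε n := Real.sqrt_nonneg _
    exact ⟨fun μ hμ => (NWDRO.exists_coupling_of_mem_ambiguitySet hp1 hp hclosed hL hw
        (fun i => hω i) hε0 (lt_add_one _) hμ).1,
      NWDRO.nonempty_ballCosts hp1 hp hclosed _ hw (NWDRO.sum_nwWeight hmass) (fun i => hω i) hε0,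
      NWDRO.bddAbove_ballCosts hp1 hp hclosed hL hw (fun i => hω i) hε0⟩
  · obtain ⟨b, hb, hev⟩ := hmain 1 one_pos
    have hlow : Tendsto (fun n : ℕ => 1 - ENNReal.ofReal (Real.exp (-(b * (n * h n ^ m)))))
        atTop (𝓝 1) := by
      simpa using ENNReal.Tendsto.sub tendsto_const_nhds
        (NWDRO.tendsto_exp_neg_mul_atTop hband hb) (Or.inl ENNReal.one_ne_top)
    refine tendsto_of_tendsto_of_tendsto_of_le_of_le' hlow tendsto_const_nhds ?_
      (Eventually.of_forall fun n => prob_le_one)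
    filter_upwards [hev] with n hn
    rw [tsub_le_iff_right]
    -- Subadditivity replaces the formula for the measure of a complement, so measurability of the
    -- error is not needed.
    calc (1 : ℝ≥0∞) = P Set.univ := measure_univ.symm
      _ ≤ P ({ω | 0 < NWDRO.kernelMass K (h n) x (xs n ω)} ∪
            {ω | ¬ (0 < NWDRO.kernelMass K (h n) x (xs n ω) ∧ err n ω ≤ 1 * ε n)}) := by
          refine measure_mono fun ω _ => ?_
          by_cases hω : 0 < NWDRO.kernelMass K (h n) x (xs n ω)
          · exact Or.inl hω
          · exact Or.inr fun hcon => hω hcon.1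
      _ ≤ _ := (measure_union_le _ _).trans (by gcongr)
  · refine tendstoInMeasure_of_ne_top fun η hη hηtop => ?_
    have hη' : 0 < η.toReal := ENNReal.toReal_pos hη.ne' hηtop
    -- Half the threshold, because convergence in measure concerns the non-strict event that the
    -- ratio is at least `η`.
    obtain ⟨b, hb, hev⟩ := hmain (η.toReal / 2) (half_pos hη')
    refine tendsto_of_tendsto_of_tendsto_of_le_of_le' tendsto_const_nhds
      (NWDRO.tendsto_exp_neg_mul_atTop hband hb) (Eventually.of_forall fun n => zero_le) ?_
    filter_upwards [hev, hεpos] with n hn hεn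
    refine (measure_mono fun ω hω hgood => ?_).trans hn
    rw [Set.mem_ofPred_eq, edist_zero_right, ← ofReal_norm,
      ENNReal.le_ofReal_iff_toReal_le hηtop (norm_nonneg _), Real.norm_eq_abs, abs_div,
      abs_of_pos hεn, herr, le_div_iff₀ hεn] at hω
    have h1 : err n ω ≤ η.toReal / 2 * ε n := hgood.2
    nlinarith [mul_pos hη' hεn]
  · intro hlog
    -- Tolerances `1 / (k + 1)` suffice, and a countable family keeps the exceptional set null.
    have hBC : ∀ k : ℕ, ∀ᵐ ω ∂P, ∀ᶠ n in atTop,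
        0 < NWDRO.kernelMass K (h n) x (xs n ω) ∧ err n ω ≤ 1 / ((k : ℝ) + 1) * ε n := fun k => by
      obtain ⟨b, hb, hev⟩ := hmain (1 / ((k : ℝ) + 1)) (by positivity)
      exact NWDRO.ae_eventually_of_measure_compl_le hb hlog hev
    filter_upwards [ae_all_iff.2 hBC] with ω hω
    refine ⟨(hω 0).mono fun n hn => hn.1, Metric.tendsto_nhds.2 fun η hη => ?_⟩
    obtain ⟨k, hk⟩ := exists_nat_one_div_lt hη
    filter_upwards [hω k, hεpos] with n hn hεn
    rw [Real.dist_0_eq_abs, abs_div, abs_of_pos hεn, herr,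
      div_lt_iff₀ hεn]
    exact hn.2.trans_lt (mul_lt_mul_of_pos_right hk hεn)
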